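/- Theorem 2.5. Let $\pi$ be a probability distribution on $\mathbb{R}$ with mean $0$ and variance $1$ that is subgaussian, i.e. for some $c>0$, $\mathbb{E}_{X\sim\pi}[\exp(tX)]\le\exp(ct^2)$ for all $t\in\mathbb{R}$, and let $\lambda\in(0,1)$. For $\mu\in\{0,\lambda\}$ let $\mathbb{P}_\mu=\mathbb{P}_{\mu,\pi,n}$ be the law of the symmetric $n\times n$ random matrix $$Y=\mu\,\frac{xx^\top}{\|x\|^2}+W,$$ where $x\in\mathbb{R}^n$ has i.i.d. entries drawn from $\pi$ (with $xx^\top/\|x\|^2:=0$ if $x=0$), and $W$ is independent of $x$ and symmetric, with $\{W_{ij}:i\le j\}$ independent, $W_{ij}\sim\mathcal{N}(0,1/n)$ for $i\neq j$ and $W_{ii}\sim\mathcal{N}(0,2/n)$. Then $\mathbb{P}_\lambda$ is absolutely continuous with respect to $\mathbb{P}_0$, and the likelihood ratio $L_\lambda=d\mathbb{P}_\lambda/d\mathbb{P}_0$ lies in $L^2(\mathbb{P}_0)$. Let $(L_\lambda)^{\le D}$ denote the orthogonal projection in $L^2(\mathbb{P}_0)$ of $L_\lambda$ onto the subspace of polynomial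 functions of degree at most $D$ in the entries of $Y$, and let $\|f\|=(\mathbb{E}_{Y\sim\mathbb{P}_0}[f(Y)^2])^{1/2}$. (i) For every sequence of non-negative integers $D=D_n$ with $D_n\to\infty$ and $D_n=o(n/\log n)$, $$\lim_{n\to\infty}\|(L_\lambda)^{\le D_n}\|=(1-\lambda^2)^{-1/4}.$$ (ii) For every sequence of non-negative integers $D=D_n$ with $D_n=o(n/\log n)$ (not necessarily tending to infinity), $$\|(L_\lambda)^{\le D_n}\|\le(1-\lambda^2)^{-1/4}+o(1)\qquad\text{as }n\to\infty.$$ -/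

import Mathlib

open MeasureTheory ProbabilityTheory Filter Topology Asymptotics
open scoped ENNReal NNReal

namespace SpikedWigner

/-- The assumption on the spike prior: a law on `ℝ` that is centered, has unit variance and is
subgaussian. (The law is a probability measure; this is a separate instance argument.)
The subgaussian condition includes that the exponential moments are finite, so the Bochner
integrals here are genuine expectations. -/
structure IsSpikePrior (π : Measure ℝ) : Prop where
  centered : ∫ x, x ∂π = 0
  unit_variance : ∫ x, x ^ 2 ∂π = 1
  subgaussian : ∃ c : ℝ, 0 < c ∧ ∀ t : ℝ,
    Integrable (fun x => Real.exp (t * x)) π ∧ ∫ x, Real.exp (t * x) ∂π ≤ Real.exp (c * t ^ 2)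

/-- The sample space of real `n × n` arrays `Y i j`, with its product (Borel) σ-algebra. All laws
below are concentrated on the symmetric ones. -/
abbrev Mat (n : ℕ) : Type := Fin n → Fin n → ℝ

/-- The symmetric matrix with entries `w s(i, j)` on the unordered index pairs. -/
def symMat {n : ℕ} (w : Sym2 (Fin n) → ℝ) : Mat n := fun i j => w s(i, j)

/-- The Gaussian Orthogonal Ensemble: the law of a symmetric matrix whose entries `W i j`, `i ≤ j`,
are independent, `N(0, 1/n)` off the diagonal and `N(0, 2/n)` on it. -/
noncomputable def goe (n : ℕ) : Measure (Mat n) :=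
  (Measure.pi fun e : Sym2 (Fin n) =>
    gaussianReal 0 (if e.IsDiag then 2 / (n : ℝ≥0) else 1 / (n : ℝ≥0))).map symMat

/-- The rank-one matrix `x xᵀ / ‖x‖²` (Euclidean norm); it is `0` when `x = 0`, since
`0 / 0 = 0`. -/
noncomputable def spike {n : ℕ} (x : Fin n → ℝ) : Mat n :=
  fun i j => x i * x j / ∑ k, x k ^ 2

/-- The spiked Wigner law `P_{lam, π, n}`: the law of `lam • x xᵀ / ‖x‖² + W`, with the entries of
`x` i.i.d. from `π` and `W` an independent GOE matrix. -/
noncomputable def spikedWigner (lam : ℝ) (π : Measure ℝ) (n : ℕ) : Measure (Mat n) :=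
  ((Measure.pi fun _ : Fin n => π).prod (goe n)).map fun xW => lam • spike xW.1 + xW.2

/-- The likelihood ratio `dP/dQ`, as a real-valued function. -/
noncomputable def likelihoodRatio {n : ℕ} (P Q : Measure (Mat n)) : Mat n → ℝ :=
  fun Y => (P.rnDeriv Q Y).toReal

/-- The spiked Wigner likelihood ratio `dP_{lam, π, n} / dP_{0, π, n}`. -/
noncomputable def spikedLR (lam : ℝ) (π : Measure ℝ) (n : ℕ) : Mat n → ℝ :=
  likelihoodRatio (spikedWigner lam π n) (spikedWigner 0 π n)

/-- The value at the matrix `Y` of a polynomial in the entries. -/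
noncomputable def polyEval {n : ℕ} (p : MvPolynomial (Fin n × Fin n) ℝ) (Y : Mat n) : ℝ :=
  MvPolynomial.eval (fun ij : Fin n × Fin n => Y ij.1 ij.2) p

/-- The subspace of `L²(Q)` of (classes of) polynomial functions of degree at most `D` in the
entries of the matrix. -/
noncomputable def lowDegree {n : ℕ} (Q : Measure (Mat n)) (D : ℕ) : Submodule ℝ (Lp ℝ 2 Q) where
  carrier := {f | ∃ p : MvPolynomial (Fin n × Fin n) ℝ, p.totalDegree ≤ D ∧ f =ᵐ[Q] polyEval p}
  zero_mem' := ⟨0, by simp, by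
    filter_upwards [Lp.coeFn_zero ℝ 2 Q] with Y hY
    rw [hY]; simp [polyEval]⟩
  add_mem' := by
    rintro f g ⟨p, hp, hfp⟩ ⟨q, hq, hgq⟩
    refine ⟨p + q, (MvPolynomial.totalDegree_add p q).trans (max_le hp hq), ?_⟩
    filter_upwards [Lp.coeFn_add f g, hfp, hgq] with Y h1 h2 h3
    rw [h1, Pi.add_apply, h2, h3]; simp [polyEval]
  smul_mem' := by
    rintro c f ⟨p, hp, hfp⟩
    refine ⟨c • p, (MvPolynomial.totalDegree_smul_le c p).trans hp, ?_⟩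
    filter_upwards [Lp.coeFn_smul c f, hfp] with Y h1 h2
    rw [h1, Pi.smul_apply, h2]; simp [polyEval]

/-- The subspace of polynomial functions of degree at most `D` is finite-dimensional. It therefore
has an orthogonal projection. -/
instance lowDegree_finite {n : ℕ} (Q : Measure (Mat n)) (D : ℕ) :
    Module.Finite ℝ (lowDegree Q D) := by
  have hadd : ∀ p q : MvPolynomial (Fin n × Fin n) ℝ,
      polyEval (p + q) = polyEval p + polyEval q := by
    intro p q; ext Y; simp [polyEval]
  have hsmul : ∀ (c : ℝ) (p : MvPolynomial (Fin n × Fin n) ℝ),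
      polyEval (c • p) = c • polyEval p := by
    intro c p; ext Y; simp [polyEval]
  let T : Submodule ℝ (MvPolynomial (Fin n × Fin n) ℝ) :=
    { carrier := {p | p.totalDegree ≤ D ∧ MemLp (polyEval p) 2 Q}
      zero_mem' := ⟨by simp, by
        have : polyEval (0 : MvPolynomial (Fin n × Fin n) ℝ) = 0 := by ext Y; simp [polyEval]
        rw [this]; exact MemLp.zero⟩
      add_mem' := fun {p q} hp hq =>
        ⟨(MvPolynomial.totalDegree_add p q).trans (max_le hp.1 hq.1), by
          rw [hadd]; exact hp.2.add hq.2⟩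
      smul_mem' := fun c p hp =>
        ⟨(MvPolynomial.totalDegree_smul_le c p).trans hp.1, by
          rw [hsmul]; exact hp.2.const_smul c⟩ }
  have hT : T ≤ MvPolynomial.restrictTotalDegree (Fin n × Fin n) ℝ D := fun p hp =>
    (MvPolynomial.mem_restrictTotalDegree _ _ _).2 hp.1
  have : Module.Finite ℝ T := Submodule.finiteDimensional_of_le hT
  let F : T →ₗ[ℝ] lowDegree Q D :=
    { toFun := fun p => ⟨p.2.2.toLp _, p.1, p.2.1, p.2.2.coeFn_toLp⟩
      map_add' := fun p q => Subtype.ext <|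
        (MemLp.toLp_congr (p + q).2.2 (p.2.2.add q.2.2)
          (Eventually.of_forall fun Y => congrFun (hadd p q) Y)).trans
          (MemLp.toLp_add p.2.2 q.2.2)
      map_smul' := fun c p => Subtype.ext <|
        (MemLp.toLp_congr (c • p).2.2 (p.2.2.const_smul c)
          (Eventually.of_forall fun Y => congrFun (hsmul c p) Y)).trans
          (MemLp.toLp_const_smul c p.2.2) }
  refine Module.Finite.of_surjective F ?_
  rintro ⟨f, p, hp, hf⟩
  have hm : MemLp (polyEval p) 2 Q := (memLp_congr_ae hf).1 (Lp.memLp f)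
  have h : hm.toLp (polyEval p) = f := Lp.ext (hm.coeFn_toLp.trans hf.symm)
  exact ⟨⟨p, hp, hm⟩, Subtype.ext h⟩

/-- The degree-`D` part `L^{≤ D}` of `L ∈ L²(Q)`: its orthogonal projection in `L²(Q)` onto the
polynomial functions of degree at most `D`. -/
noncomputable def lowDegreePart {n : ℕ} (Q : Measure (Mat n)) (D : ℕ) (L : Mat n → ℝ)
    (hL : MemLp L 2 Q) : Lp ℝ 2 Q :=
  (lowDegree Q D).starProjection (hL.toLp L)

end SpikedWigner

/-! Under the null law the entries are independent centred Gaussians, so products of Hermite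
polynomials in the rescaled entries form an orthogonal basis of the polynomials of degree at most
`D`, the product indexed by `k` having squared norm `∏ k_e!`. Given the spike `x`, the planted law
is a Gaussian shift, and the mean of the `k`-th Hermite polynomial under a shift by `a` is `a ^ k`
(`integral_hermiteReal_add`). The Hermite coefficients of the likelihood ratio are therefore mixed
moments of the signal.

Parseval, with each squared moment written as an expectation over two independent spikes `x`, `y`,
and the multinomial theorem collapse the squared norm to `∑_{d ≤ D} (λ²/2)^d / d! · E[(n R)^d]`,
where `R` is the squared cosine of the angle between `x` and `y` (`norm_lowDegreePart_sq`). By the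
central limit theorem for `∑ x_i y_i` and the law of large numbers for the squared norms, `n R`
converges in law to `g²` with `g` standard normal (`tendstoInDistribution_seqOverlap`). The formal
limit is `E[exp(λ² g² / 2)] = (1 - λ²)^(-1/2)`, and the norm is its square root.

Limit and sum are exchanged by dominated convergence, using a summable bound uniform over `d log n ≤
κ n` (`exists_summable_bound`). Unless one of the squared norms falls below `(1 - η) n`, `n R` is
controlled by moments of `∑ x_i y_i`. Subgaussianity makes these almost Gaussian and gives geometric
decay at rate `λ² (1 + η) / (1 - η)² < 1`. The exceptional event has probability at most `2 exp(-c
n)` and costs at most `n^d` there; the product is harmless exactly because `d log n ≤ c n`. This is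
where `D = o(n / log n)` enters.

The upper bound for arbitrary `D` follows because the norm increases with the degree, so `D` may be
enlarged until it diverges. -/

namespace SpikedWigner

/-! ### Hermite polynomials under a one-dimensional Gaussian -/

section HermiteGaussian

open Polynomial

/-- The probabilists' Hermite polynomial with real coefficients. -/
noncomputable def hermiteReal (k : ℕ) : ℝ[X] := (hermite k).map (Int.castRingHom ℝ)

lemma hermiteReal_zero : hermiteReal 0 = 1 := by simp [hermiteReal]

lemma hermiteReal_succ (k : ℕ) :
    hermiteReal (k + 1) = X * hermiteReal k - derivative (hermiteReal k) := by
  simp [hermiteReal, hermite_succ, derivative_map]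

lemma hermiteReal_monic (k : ℕ) : (hermiteReal k).Monic := (hermite_monic k).map _

lemma natDegree_hermiteReal (k : ℕ) : (hermiteReal k).natDegree = k := by
  rw [hermiteReal, (hermite_monic k).natDegree_map, natDegree_hermite]

lemma integrable_pow_gaussianReal (m : ℝ) (v : ℝ≥0) (k : ℕ) :
    Integrable (fun x => x ^ k) (gaussianReal m v) := by
  have h : (0 : ℝ) ∈ interior (integrableExpSet (fun x : ℝ => x) (gaussianReal m v)) := by simp
  exact integrable_pow_of_mem_interior_integrableExpSet h k

lemma integrable_eval_gaussianReal (p : ℝ[X]) (m : ℝ) (v : ℝ≥0) :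
    Integrable (fun x => p.eval x) (gaussianReal m v) := by
  simp_rw [eval_eq_sum_range]
  exact integrable_finsetSum _ fun i _ => (integrable_pow_gaussianReal m v i).const_mul _

lemma hasDerivAt_gaussianPDFReal_zero_one (x : ℝ) :
    HasDerivAt (gaussianPDFReal 0 1) (-x * gaussianPDFReal 0 1 x) x := by
  have h1 : HasDerivAt (fun x : ℝ => -(x - 0) ^ 2 / (2 * ((1 : ℝ≥0) : ℝ))) (-x) x := by
    have := ((((hasDerivAt_id x).sub_const 0).pow 2).neg).div_const (2 * ((1 : ℝ≥0) : ℝ))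
    refine this.congr_deriv ?_
    simp
    ring
  have h2 := (h1.exp).const_mul (√(2 * Real.pi * ((1 : ℝ≥0) : ℝ)))⁻¹
  rw [gaussianPDFReal_def]
  refine h2.congr_deriv ?_
  ring

/-- **Stein's identity** for polynomials under the standard normal law. -/
lemma integral_stein_gaussianReal (p : ℝ[X]) :
    ∫ x, (X * p - derivative p).eval x ∂(gaussianReal 0 1) = 0 := by
  have hint : ∀ q : ℝ[X], Integrable (fun x => gaussianPDFReal 0 1 x * q.eval x) := by
    intro q
    have h := integrable_eval_gaussianReal q 0 1
    rw [gaussianReal_of_var_ne_zero _ one_ne_zero,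
      integrable_withDensity_iff_integrable_smul' (measurable_gaussianPDF _ _)
        (ae_of_all _ fun x => gaussianPDF_lt_top)] at h
    simpa using h
  have hd : ∀ x, HasDerivAt (fun x => gaussianPDFReal 0 1 x * p.eval x)
      (gaussianPDFReal 0 1 x * (-(X * p - derivative p)).eval x) x := by
    intro x
    refine ((hasDerivAt_gaussianPDFReal_zero_one x).mul (p.hasDerivAt x)).congr_deriv ?_
    simp
    ring
  have h := integral_eq_zero_of_hasDerivAt_of_integrable hd (hint _) (hint _)
  rw [integral_gaussianReal_eq_integral_smul one_ne_zero]
  simp only [eval_neg, mul_neg, integral_neg, neg_eq_zero] at h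
  simpa using h

/-- Stein's identity for the product of `hermiteReal k` and `q`: the Hermite raising operator is
adjoint to differentiation. Iterating moves every derivative onto `q`. -/
lemma integral_hermiteReal_succ_mul (k : ℕ) (q : ℝ[X]) :
    ∫ x, (hermiteReal (k + 1) * q).eval x ∂(gaussianReal 0 1)
      = ∫ x, (hermiteReal k * derivative q).eval x ∂(gaussianReal 0 1) := by
  have h := integral_stein_gaussianReal (hermiteReal k * q)
  have e : X * (hermiteReal k * q) - derivative (hermiteReal k * q)
      = hermiteReal (k + 1) * q - hermiteReal k * derivative q := by
    rw [hermiteReal_succ, derivative_mul]; ring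
  rw [e] at h
  simp only [eval_sub] at h
  rw [integral_sub (integrable_eval_gaussianReal _ _ _) (integrable_eval_gaussianReal _ _ _)] at h
  linarith

lemma integral_hermiteReal_mul (k : ℕ) (q : ℝ[X]) :
    ∫ x, (hermiteReal k * q).eval x ∂(gaussianReal 0 1)
      = ∫ x, (derivative^[k] q).eval x ∂(gaussianReal 0 1) := by
  induction k generalizing q with
  | zero => simp [hermiteReal_zero]
  | succ k ih => rw [integral_hermiteReal_succ_mul, ih, Function.iterate_succ_apply]

/-- Taking `k ≤ j`, all `j` derivatives fall on a monic polynomial of degree `k`: they annihilate it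
if `k < j` and leave the constant `k!` if `k = j`. -/
lemma integral_hermiteReal_mul_hermiteReal (j k : ℕ) :
    ∫ x, (hermiteReal j).eval x * (hermiteReal k).eval x ∂(gaussianReal 0 1)
      = if j = k then (k.factorial : ℝ) else 0 := by
  wlog hjk : k ≤ j generalizing j k
  · have hne : j ≠ k := by omega
    have h := this k j (by omega)
    rw [if_neg hne.symm] at h
    rw [if_neg hne]
    exact (integral_congr_ae (ae_of_all _ fun x => mul_comm _ _)).trans h
  have h := integral_hermiteReal_mul j (hermiteReal k)
  simp only [eval_mul] at h
  rw [h]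
  rcases hjk.lt_or_eq with hlt | rfl
  · rw [if_neg (by omega), iterate_derivative_eq_zero (by rwa [natDegree_hermiteReal])]
    simp
  · have hc : derivative^[k] (hermiteReal k) = C (k.factorial : ℝ) := by
      have hd : (derivative^[k] (hermiteReal k)).natDegree ≤ 0 := by
        have := natDegree_iterate_derivative (hermiteReal k) k
        rwa [natDegree_hermiteReal, Nat.sub_self] at this
      rw [eq_C_of_natDegree_le_zero hd, coeff_iterate_derivative]
      have hm := (hermiteReal_monic k).coeff_natDegree
      rw [natDegree_hermiteReal] at hm
      simp [hm, Nat.descFactorial_self]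
    simp [hc]

/-- Stein's identity for the translated polynomial shows that raising the index by one multiplies
the mean by `a`. This turns likelihood-ratio coefficients into moments of the signal. -/
lemma integral_hermiteReal_add (k : ℕ) (a : ℝ) :
    ∫ x, (hermiteReal k).eval (a + x) ∂(gaussianReal 0 1) = a ^ k := by
  induction k with
  | zero => simp [hermiteReal_zero]
  | succ k ih =>
    have h := integral_stein_gaussianReal ((hermiteReal k).comp (C a + X))
    have e : X * (hermiteReal k).comp (C a + X) - derivative ((hermiteReal k).comp (C a + X))
        = (hermiteReal (k + 1)).comp (C a + X) - C a * (hermiteReal k).comp (C a + X) := by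
      rw [hermiteReal_succ, derivative_comp]
      simp
      ring
    rw [e] at h
    simp only [eval_sub] at h
    rw [integral_sub (integrable_eval_gaussianReal _ _ _) (integrable_eval_gaussianReal _ _ _)] at h
    simp only [eval_comp, eval_mul, eval_add, eval_C, eval_X, integral_const_mul, ih] at h
    rw [pow_succ]
    linarith

/-- The `k`-th Hermite polynomial, rescaled to be orthogonal for a centered Gaussian of variance
`v`. -/
noncomputable def hermiteScaled (v : ℝ≥0) (k : ℕ) (x : ℝ) : ℝ :=
  (hermiteReal k).eval (x / √(v : ℝ))

lemma gaussianReal_map_div_sqrt {v : ℝ≥0} (hv : v ≠ 0) :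
    (gaussianReal 0 v).map (fun x => x / √(v : ℝ)) = gaussianReal 0 1 := by
  rw [gaussianReal_map_div_const]
  congr 1
  · simp
  · ext
    have : (v : ℝ) ≠ 0 := by exact_mod_cast hv
    simp [Real.sq_sqrt, this]

@[fun_prop]
lemma continuous_hermiteScaled (v : ℝ≥0) (k : ℕ) : Continuous (hermiteScaled v k) := by
  unfold hermiteScaled; fun_prop

lemma integral_comp_div_sqrt_gaussianReal {v : ℝ≥0} (hv : v ≠ 0) {f : ℝ → ℝ} (hf : Continuous f) :
    ∫ x, f (x / √(v : ℝ)) ∂(gaussianReal 0 v) = ∫ x, f x ∂(gaussianReal 0 1) := by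
  rw [← gaussianReal_map_div_sqrt hv, integral_map (by fun_prop) hf.aestronglyMeasurable]

lemma integral_hermiteScaled_mul {v : ℝ≥0} (hv : v ≠ 0) (j k : ℕ) :
    ∫ x, hermiteScaled v j x * hermiteScaled v k x ∂(gaussianReal 0 v)
      = if j = k then (k.factorial : ℝ) else 0 := by
  rw [← integral_hermiteReal_mul_hermiteReal]
  exact integral_comp_div_sqrt_gaussianReal hv
    (f := fun x => (hermiteReal j).eval x * (hermiteReal k).eval x) (by fun_prop)

lemma integral_hermiteScaled_add {v : ℝ≥0} (hv : v ≠ 0) (k : ℕ) (m : ℝ) :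
    ∫ x, hermiteScaled v k (m + x) ∂(gaussianReal 0 v) = (m / √(v : ℝ)) ^ k := by
  rw [← integral_hermiteReal_add]
  simp_rw [hermiteScaled, add_div]
  exact integral_comp_div_sqrt_gaussianReal hv
    (f := fun x => (hermiteReal k).eval (m / √(v : ℝ) + x)) (by fun_prop)

lemma integrable_hermiteScaled_mul (v : ℝ≥0) (j k : ℕ) :
    Integrable (fun x => hermiteScaled v j x * hermiteScaled v k x) (gaussianReal 0 v) := by
  have h := integrable_eval_gaussianReal
    ((hermiteReal j * hermiteReal k).comp (C (√(v : ℝ))⁻¹ * X)) 0 v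
  refine h.congr (ae_of_all _ fun x => ?_)
  simp [hermiteScaled, div_eq_inv_mul]

/-- Monic of degree `m`, the Hermite polynomial differs from `X ^ m` by lower powers, so the change
of basis is triangular. -/
lemma X_pow_mem_span_hermiteReal (m : ℕ) :
    (X ^ m : ℝ[X]) ∈ Submodule.span ℝ (hermiteReal '' (Finset.range (m + 1) : Finset ℕ)) := by
  induction m using Nat.strong_induction_on with
  | _ m ih =>
    have hsplit : (X ^ m : ℝ[X])
        = hermiteReal m - ∑ i ∈ Finset.range m, (hermiteReal m).coeff i • X ^ i := by
      have h := (hermiteReal_monic m).as_sum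
      rw [natDegree_hermiteReal] at h
      rw [eq_sub_iff_add_eq]
      conv_rhs => rw [h]
      simp [smul_eq_C_mul]
    rw [hsplit]
    refine Submodule.sub_mem _ (Submodule.subset_span ⟨m, by simp, rfl⟩) ?_
    refine Submodule.sum_mem _ fun i hi => Submodule.smul_mem _ _ ?_
    have hi' := Finset.mem_range.1 hi
    refine Submodule.span_mono (Set.image_mono ?_) (ih i hi')
    exact_mod_cast Finset.range_mono (by omega)

lemma exists_pow_eq_sum_hermiteScaled {v : ℝ≥0} (hv : v ≠ 0) (m : ℕ) :
    ∃ c : ℕ → ℝ, ∀ x : ℝ, x ^ m = ∑ i ∈ Finset.range (m + 1), c i * hermiteScaled v i x := by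
  obtain ⟨c, hc⟩ :=
    (Submodule.mem_span_image_finset_iff_exists_fun ℝ).1 (X_pow_mem_span_hermiteReal m)
  have hs : √(v : ℝ) ≠ 0 := by
    have : (0 : ℝ) < v := by exact_mod_cast pos_iff_ne_zero.2 hv
    positivity
  refine ⟨fun i => if h : i ∈ Finset.range (m + 1) then √(v : ℝ) ^ m * c ⟨i, h⟩ else 0,
    fun x => ?_⟩
  have h := congrArg (fun p : ℝ[X] => √(v : ℝ) ^ m * p.eval (x / √(v : ℝ))) hc
  simp only [eval_finsetSum, eval_smul, eval_pow, eval_X, div_pow, smul_eq_mul] at h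
  rw [mul_div_cancel₀ _ (pow_ne_zero _ hs)] at h
  rw [← h, Finset.mul_sum, ← Finset.sum_attach (Finset.range (m + 1))]
  refine Finset.sum_congr rfl fun i _ => ?_
  have hi := i.2
  simp only [hi, dif_pos, hermiteScaled]
  ring

end HermiteGaussian

/-- Parseval's identity for the orthogonal projection onto the span of finitely many pairwise
orthogonal vectors. -/
lemma norm_starProjection_sq_eq_sum {E ι : Type*} [NormedAddCommGroup E] [InnerProductSpace ℝ E]
    [DecidableEq ι] (K : Submodule ℝ E) [K.HasOrthogonalProjection] (s : Finset ι) (b : ι → E)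
    (c : ι → ℝ) (hc : ∀ k ∈ s, c k ≠ 0)
    (horth : ∀ j ∈ s, ∀ k ∈ s, inner ℝ (b j) (b k) = if j = k then c k else 0)
    (hbK : ∀ k ∈ s, b k ∈ K) (hKb : ∀ f ∈ K, ∃ a : ι → ℝ, f = ∑ k ∈ s, a k • b k) (u : E) :
    ‖K.starProjection u‖ ^ 2 = ∑ k ∈ s, (inner ℝ (b k) u) ^ 2 / c k := by
  set p : E := ∑ k ∈ s, (inner ℝ (b k) u / c k) • b k with hp
  have hbp : ∀ j ∈ s, inner ℝ (b j) p = inner ℝ (b j) u := by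
    intro j hj
    rw [hp, inner_sum, Finset.sum_eq_single_of_mem j hj]
    · rw [inner_smul_right, horth j hj j hj, if_pos rfl, div_mul_cancel₀ _ (hc j hj)]
    · intro k hk hkj
      rw [inner_smul_right, horth j hj k hk, if_neg hkj.symm, mul_zero]
  have hproj : K.starProjection u = p := by
    refine Submodule.eq_starProjection_of_mem_of_inner_eq_zero
      (K.sum_mem fun k hk => K.smul_mem _ (hbK k hk)) fun f hf => ?_
    obtain ⟨a, rfl⟩ := hKb f hf
    rw [inner_sum]
    refine Finset.sum_eq_zero fun k hk => ?_
    rw [inner_smul_right, inner_sub_left, real_inner_comm, real_inner_comm (b k) p, hbp k hk,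
      sub_self, mul_zero]
  rw [hproj, ← real_inner_self_eq_norm_sq]
  conv_lhs => rw [hp, sum_inner]
  refine Finset.sum_congr rfl fun k hk => ?_
  rw [inner_smul_left, hbp k hk]
  simp
  ring

/-! ### Gaussian vectors: Cameron–Martin formula and multivariate Hermite products -/

section GaussianShift

variable {ι : Type*} [Fintype ι]

lemma lintegral_pi_prod_eq_prod_lintegral {μ : ι → Measure ℝ} [∀ i, IsProbabilityMeasure (μ i)]
    {f : ι → ℝ → ℝ≥0∞} (hf : ∀ i, Measurable (f i)) :
    ∫⁻ w, ∏ i, f i (w i) ∂(Measure.pi μ) = ∏ i, ∫⁻ x, f i x ∂(μ i) := by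
  rw [lintegral_prod_eq_prod_lintegral_of_indepFun Finset.univ (fun i (w : ι → ℝ) => f i (w i))
    (iIndepFun_pi fun i => (hf i).aemeasurable) (fun i => by fun_prop)]
  refine Finset.prod_congr rfl fun i _ => ?_
  exact (measurePreserving_eval μ i).lintegral_comp (hf i)

lemma pi_withDensity {μ : ι → Measure ℝ} [∀ i, IsProbabilityMeasure (μ i)]
    {f : ι → ℝ → ℝ≥0∞} (hf : ∀ i, Measurable (f i)) [∀ i, SigmaFinite ((μ i).withDensity (f i))] :
    Measure.pi (fun i => (μ i).withDensity (f i))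
      = (Measure.pi μ).withDensity (fun w => ∏ i, f i (w i)) := by
  refine Measure.pi_eq fun s hs => ?_
  rw [withDensity_apply _ (MeasurableSet.univ_pi hs),
    ← lintegral_indicator (MeasurableSet.univ_pi hs)]
  have h : (fun w : ι → ℝ => (Set.univ.pi s).indicator (fun w => ∏ i, f i (w i)) w)
      = fun w => ∏ i, (s i).indicator (f i) (w i) := by
    ext w
    by_cases hw : w ∈ Set.univ.pi s
    · rw [Set.indicator_of_mem hw]
      refine Finset.prod_congr rfl fun i _ => ?_
      rw [Set.indicator_of_mem (hw i (Set.mem_univ i))]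
    · rw [Set.indicator_of_notMem hw]
      simp only [Set.mem_univ_pi, not_forall] at hw
      obtain ⟨i, hi⟩ := hw
      exact (Finset.prod_eq_zero (Finset.mem_univ i) (Set.indicator_of_notMem hi _)).symm
  rw [h, lintegral_pi_prod_eq_prod_lintegral fun i => (hf i).indicator (hs i)]
  refine Finset.prod_congr rfl fun i _ => ?_
  rw [lintegral_indicator (hs i), withDensity_apply _ (hs i)]

lemma gaussianReal_eq_withDensity (m : ℝ) {v : ℝ≥0} (hv : v ≠ 0) :
    gaussianReal m v = (gaussianReal 0 v).withDensity
      (fun x => ENNReal.ofReal (Real.exp (m * x / v - m ^ 2 / (2 * v)))) := by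
  rw [gaussianReal_of_var_ne_zero _ hv, gaussianReal_of_var_ne_zero _ hv,
    ← withDensity_mul _ (measurable_gaussianPDF _ _) (by fun_prop)]
  congr 1
  ext x
  have hv' : (v : ℝ) ≠ 0 := by exact_mod_cast hv
  rw [Pi.mul_apply, gaussianPDF, gaussianPDF, ← ENNReal.ofReal_mul (gaussianPDFReal_nonneg _ _ _),
    gaussianPDFReal, gaussianPDFReal, mul_assoc (√_)⁻¹, ← Real.exp_add]
  congr 3
  field_simp
  ring

/-- The density of the Gaussian vector with mean `m` and independent coordinates of variances `v`
with respect to the centered one. -/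
noncomputable def shiftDensity (v : ι → ℝ≥0) (m w : ι → ℝ) : ℝ :=
  ∏ i, Real.exp (m i * w i / v i - m i ^ 2 / (2 * v i))

/-- The **Cameron–Martin formula** for independent centered Gaussians. -/
lemma lintegral_pi_gaussianReal_add {v : ι → ℝ≥0} (hv : ∀ i, v i ≠ 0) (m : ι → ℝ)
    {f : (ι → ℝ) → ℝ≥0∞} (hf : Measurable f) :
    ∫⁻ w, f (m + w) ∂(Measure.pi fun i => gaussianReal 0 (v i))
      = ∫⁻ w, ENNReal.ofReal (shiftDensity v m w) * f w
          ∂(Measure.pi fun i => gaussianReal 0 (v i)) := by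
  have hmap : (Measure.pi fun i => gaussianReal 0 (v i)).map (fun w i => m i + w i)
      = Measure.pi fun i => gaussianReal (m i) (v i) := by
    have : ∀ i, SigmaFinite ((gaussianReal 0 (v i)).map (m i + ·)) := by
      intro i; rw [gaussianReal_map_const_add]; infer_instance
    rw [Measure.pi_map_pi (f := fun i x => m i + x) (fun i => by fun_prop)]
    simp_rw [gaussianReal_map_const_add, zero_add]
  have hdens : (Measure.pi fun i => gaussianReal (m i) (v i))
      = (Measure.pi fun i => gaussianReal 0 (v i)).withDensity
        (fun w => ENNReal.ofReal (shiftDensity v m w)) := by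
    have hfin : ∀ i, SigmaFinite ((gaussianReal 0 (v i)).withDensity
        (fun x => ENNReal.ofReal (Real.exp (m i * x / v i - m i ^ 2 / (2 * v i))))) := by
      intro i; rw [← gaussianReal_eq_withDensity _ (hv i)]; infer_instance
    have h := pi_withDensity (μ := fun i => gaussianReal 0 (v i))
      (f := fun i x => ENNReal.ofReal (Real.exp (m i * x / v i - m i ^ 2 / (2 * v i))))
      (fun i => by fun_prop)
    simp_rw [← gaussianReal_eq_withDensity _ (hv _)] at h
    rw [h]
    congr 1
    ext w
    rw [shiftDensity, ENNReal.ofReal_prod_of_nonneg fun _ _ => (Real.exp_pos _).le]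
  have h1 : ∫⁻ w, f (m + w) ∂(Measure.pi fun i => gaussianReal 0 (v i))
      = ∫⁻ w, f w ∂((Measure.pi fun i => gaussianReal 0 (v i)).map (fun w i => m i + w i)) := by
    rw [lintegral_map hf (by fun_prop)]
    rfl
  rw [h1, hmap, hdens, lintegral_withDensity_eq_lintegral_mul _ _ hf]
  · rfl
  · unfold shiftDensity
    fun_prop

/-- The product of the rescaled Hermite polynomials of degrees `k i` in the coordinates. -/
noncomputable def hermiteProd (v : ι → ℝ≥0) (k : ι → ℕ) (w : ι → ℝ) : ℝ :=
  ∏ i, hermiteScaled (v i) (k i) (w i)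

@[fun_prop]
lemma continuous_hermiteProd (v : ι → ℝ≥0) (k : ι → ℕ) : Continuous (hermiteProd v k) := by
  unfold hermiteProd
  fun_prop

lemma integrable_hermiteProd_mul (v : ι → ℝ≥0) (j k : ι → ℕ) :
    Integrable (fun w => hermiteProd v j w * hermiteProd v k w)
      (Measure.pi fun i => gaussianReal 0 (v i)) := by
  simp_rw [hermiteProd, ← Finset.prod_mul_distrib]
  exact Integrable.fintype_prod_dep
    (f := fun i x => hermiteScaled (v i) (j i) x * hermiteScaled (v i) (k i) x)
    fun i => integrable_hermiteScaled_mul _ _ _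

lemma integral_hermiteProd_mul {v : ι → ℝ≥0} (hv : ∀ i, v i ≠ 0) [DecidableEq ι] (j k : ι → ℕ) :
    ∫ w, hermiteProd v j w * hermiteProd v k w ∂(Measure.pi fun i => gaussianReal 0 (v i))
      = if j = k then ∏ i, ((k i).factorial : ℝ) else 0 := by
  simp_rw [hermiteProd, ← Finset.prod_mul_distrib]
  rw [integral_fintype_prod_eq_prod
    (f := fun i x => hermiteScaled (v i) (j i) x * hermiteScaled (v i) (k i) x)]
  simp_rw [integral_hermiteScaled_mul (hv _)]
  split_ifs with h
  · simp [h]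
  · obtain ⟨i, hi⟩ := Function.ne_iff.1 h
    exact Finset.prod_eq_zero (Finset.mem_univ i) (if_neg hi)

lemma integral_hermiteProd_add {v : ι → ℝ≥0} (hv : ∀ i, v i ≠ 0) (k : ι → ℕ) (m : ι → ℝ) :
    ∫ w, hermiteProd v k (m + w) ∂(Measure.pi fun i => gaussianReal 0 (v i))
      = ∏ i, (m i / √(v i : ℝ)) ^ k i := by
  simp_rw [hermiteProd, Pi.add_apply]
  rw [integral_fintype_prod_eq_prod (f := fun i x => hermiteScaled (v i) (k i) (m i + x))]
  simp_rw [integral_hermiteScaled_add (hv _)]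

/-- The multi-indices of total degree at most `D`. -/
def multiIndices (ι : Type*) [Fintype ι] [DecidableEq ι] (D : ℕ) : Finset (ι → ℕ) :=
  (Finset.range (D + 1)).biUnion fun d => Finset.univ.piAntidiag d

lemma mem_multiIndices [DecidableEq ι] {D : ℕ} {k : ι → ℕ} :
    k ∈ multiIndices ι D ↔ ∑ i, k i ≤ D := by
  simp [multiIndices]

lemma sum_multiIndices [DecidableEq ι] (D : ℕ) (F : (ι → ℕ) → ℝ) :
    ∑ k ∈ multiIndices ι D, F k
      = ∑ d ∈ Finset.range (D + 1), ∑ k ∈ Finset.univ.piAntidiag d, F k := by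
  refine Finset.sum_biUnion ?_
  intro d _ d' _ hdd
  refine Finset.disjoint_left.2 fun k hk hk' => hdd ?_
  rw [Finset.mem_piAntidiag] at hk hk'
  exact hk.1.symm.trans hk'.1

/-- The exponential generating identity `∑_{|k| = d} a^k b^k / k! = ⟨a, b⟩^d / d!`. -/
lemma sum_piAntidiag_div_factorial [DecidableEq ι] (d : ℕ) (a : ι → ℝ) :
    ∑ k ∈ Finset.univ.piAntidiag d, (∏ i, a i ^ k i) / ∏ i, ((k i).factorial : ℝ)
      = (∑ i, a i) ^ d / d.factorial := by
  rw [Finset.sum_pow_eq_sum_piAntidiag, Finset.sum_div]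
  refine Finset.sum_congr rfl fun k hk => ?_
  have hsum : ∑ i, k i = d := (Finset.mem_piAntidiag.1 hk).1
  have h := Nat.multinomial_spec Finset.univ k
  rw [hsum] at h
  have h' : (∏ i, ((k i).factorial : ℝ)) * (Nat.multinomial Finset.univ k : ℝ)
      = (d.factorial : ℝ) := by exact_mod_cast h
  have h0 : (∏ i, ((k i).factorial : ℝ)) ≠ 0 :=
    Finset.prod_ne_zero_iff.2 fun i _ => by positivity
  have hd : (d.factorial : ℝ) ≠ 0 := by positivity
  rw [div_eq_div_iff h0 hd, ← h']
  ring

/-- A polynomial function of degree at most `D` is a combination of the Hermite products of degree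
at most `D`. -/
lemma exists_eval_eq_sum_hermiteProd [DecidableEq ι] {v : ι → ℝ≥0} (hv : ∀ i, v i ≠ 0)
    {D : ℕ} (p : MvPolynomial ι ℝ) (hp : p.totalDegree ≤ D) :
    ∃ a : (ι → ℕ) → ℝ, ∀ w : ι → ℝ,
      MvPolynomial.eval w p = ∑ k ∈ multiIndices ι D, a k * hermiteProd v k w := by
  have hmon : ∀ m ∈ p.support, ∃ a : (ι → ℕ) → ℝ, ∀ w : ι → ℝ,
      ∏ i, w i ^ m i = ∑ k ∈ multiIndices ι D, a k * hermiteProd v k w := by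
    intro m hm
    choose c hc using fun i => exists_pow_eq_sum_hermiteScaled (hv i) (m i)
    have hmD : ∑ i, m i ≤ D := by
      refine le_trans ?_ ((MvPolynomial.le_totalDegree hm).trans hp)
      rw [Finsupp.sum_fintype _ _ fun _ => rfl]
    refine ⟨fun k => if k ∈ Fintype.piFinset fun i => Finset.range (m i + 1) then
      ∏ i, c i (k i) else 0, fun w => ?_⟩
    rw [Finset.prod_congr rfl fun i _ => hc i (w i), Finset.prod_univ_sum]
    rw [← Finset.sum_subset (s₁ := Fintype.piFinset fun i => Finset.range (m i + 1))
      (s₂ := multiIndices ι D)]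
    · refine Finset.sum_congr rfl fun k hk => ?_
      simp only [hk, if_true, hermiteProd, Finset.prod_mul_distrib]
    · intro k hk
      rw [mem_multiIndices]
      refine (Finset.sum_le_sum fun i _ => ?_).trans hmD
      have := Fintype.mem_piFinset.1 hk i
      rw [Finset.mem_range] at this
      omega
    · intro k _ hk
      simp only [hk, if_false, zero_mul]
  choose! a ha using hmon
  refine ⟨fun k => ∑ m ∈ p.support, p.coeff m * a m k, fun w => ?_⟩
  rw [MvPolynomial.eval_eq']
  simp_rw [Finset.sum_mul]
  rw [Finset.sum_comm]
  refine Finset.sum_congr rfl fun m hm => ?_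
  rw [ha m hm, Finset.mul_sum]
  exact Finset.sum_congr rfl fun k _ => by ring

end GaussianShift

/-! ### The planted law as a mixture of Gaussian shifts, and its square-integrable density -/

section MatrixLaw

variable {n : ℕ}

/-- The variances of the entries of a GOE matrix. -/
noncomputable def entryVar (n : ℕ) (e : Sym2 (Fin n)) : ℝ≥0 :=
  if e.IsDiag then 2 / (n : ℝ≥0) else 1 / (n : ℝ≥0)

lemma entryVar_ne_zero (e : Sym2 (Fin n)) : entryVar n e ≠ 0 := by
  -- The existence of an index `e` already forces `n > 0`.
  have hn : (n : ℝ≥0) ≠ 0 := by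
    induction e with
    | _ i j => exact_mod_cast (Nat.zero_lt_of_lt i.2).ne'
  unfold entryVar
  split_ifs <;> simp [hn]

/-- The joint law of the entries of a GOE matrix on and above the diagonal. -/
noncomputable def goeEntries (n : ℕ) : Measure (Sym2 (Fin n) → ℝ) :=
  Measure.pi fun e => gaussianReal 0 (entryVar n e)

instance : IsProbabilityMeasure (goeEntries n) := by unfold goeEntries; infer_instance

lemma goe_eq_map (n : ℕ) : goe n = (goeEntries n).map symMat := rfl

@[fun_prop]
lemma measurable_symMat : Measurable (symMat (n := n)) :=
  measurable_pi_lambda _ fun _ => measurable_pi_lambda _ fun _ => measurable_pi_apply _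

instance : IsProbabilityMeasure (goe n) := by
  rw [goe_eq_map]
  exact Measure.isProbabilityMeasure_map measurable_symMat.aemeasurable

/-- An ordered representative of an unordered pair. -/
noncomputable def pairRep (e : Sym2 (Fin n)) : Fin n × Fin n := (Sym2.mk_surjective e).choose

lemma mk_pairRep (e : Sym2 (Fin n)) : s((pairRep e).1, (pairRep e).2) = e :=
  (Sym2.mk_surjective e).choose_spec

/-- The entries of a matrix at the representatives of the unordered pairs. -/
noncomputable def pairEntries (Y : Mat n) (e : Sym2 (Fin n)) : ℝ := Y (pairRep e).1 (pairRep e).2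

lemma pairEntries_symMat (w : Sym2 (Fin n) → ℝ) : pairEntries (symMat w) = w := by
  ext e
  rw [pairEntries, symMat, mk_pairRep]

@[fun_prop]
lemma continuous_pairEntries : Continuous (pairEntries (n := n)) := by
  unfold pairEntries; fun_prop

/-- The entries of the signal matrix, indexed by unordered pairs. -/
noncomputable def spikeEntries (lam : ℝ) (x : Fin n → ℝ) : Sym2 (Fin n) → ℝ :=
  Sym2.lift ⟨fun i j => lam * spike x i j, fun i j => by simp only [spike, mul_comm (x i)]⟩

lemma smul_spike_eq_symMat (lam : ℝ) (x : Fin n → ℝ) :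
    lam • spike x = symMat (spikeEntries lam x) := by
  ext i j
  simp [symMat, spikeEntries]

lemma measurable_spikeEntries (lam : ℝ) : Measurable (spikeEntries (n := n) lam) := by
  refine measurable_pi_lambda _ fun e => ?_
  induction e with
  | _ i j => simp only [spikeEntries, Sym2.lift_mk, spike]; fun_prop

/-- Normalising by the Euclidean norm bounds every signal entry uniformly in `x`. Integrability at
fixed `n` thus needs no moment assumption on `π`. -/
lemma abs_spikeEntries_le (lam : ℝ) (x : Fin n → ℝ) (e : Sym2 (Fin n)) :
    |spikeEntries lam x e| ≤ |lam| := by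
  induction e with
  | _ i j =>
    simp only [spikeEntries, Sym2.lift_mk, spike, abs_mul]
    refine mul_le_of_le_one_right (abs_nonneg _) ?_
    have hle : ∀ k, x k ^ 2 ≤ ∑ k, x k ^ 2 := fun k =>
      Finset.single_le_sum (f := fun k => x k ^ 2) (fun _ _ => sq_nonneg _) (Finset.mem_univ k)
    rw [abs_div, abs_of_nonneg (a := ∑ k, x k ^ 2) (Finset.sum_nonneg fun _ _ => sq_nonneg _)]
    refine div_le_one_of_le₀ ?_ (Finset.sum_nonneg fun _ _ => sq_nonneg _)
    rw [abs_le]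
    constructor <;> nlinarith [hle i, hle j, sq_nonneg (x i + x j), sq_nonneg (x i - x j)]

lemma spikedWigner_zero (π : Measure ℝ) [IsProbabilityMeasure π] (n : ℕ) :
    spikedWigner 0 π n = goe n := by
  have h : (fun xW : (Fin n → ℝ) × Mat n => (0 : ℝ) • spike xW.1 + xW.2) = Prod.snd := by
    ext xW : 1
    simp
  rw [spikedWigner, h, Measure.map_snd_prod]
  simp

lemma measurable_spike_add (lam : ℝ) :
    Measurable fun xW : (Fin n → ℝ) × Mat n => lam • spike xW.1 + xW.2 := by
  simp_rw [smul_spike_eq_symMat]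
  exact (measurable_symMat.comp ((measurable_spikeEntries lam).comp measurable_fst)).add
    measurable_snd

instance (lam : ℝ) (π : Measure ℝ) [IsProbabilityMeasure π] :
    IsProbabilityMeasure (spikedWigner lam π n) :=
  Measure.isProbabilityMeasure_map (measurable_spike_add lam).aemeasurable

/-- The density of the spiked Wigner law with respect to the GOE. -/
noncomputable def spikedDensity (lam : ℝ) (π : Measure ℝ) (Y : Mat n) : ℝ≥0∞ :=
  ∫⁻ x : Fin n → ℝ, ENNReal.ofReal
    (shiftDensity (entryVar n) (spikeEntries lam x) (pairEntries Y)) ∂(Measure.pi fun _ => π)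

lemma measurable_shiftDensity_spikeEntries (lam : ℝ) :
    Measurable fun xw : (Fin n → ℝ) × (Sym2 (Fin n) → ℝ) =>
      ENNReal.ofReal (shiftDensity (entryVar n) (spikeEntries lam xw.1) xw.2) := by
  have h : ∀ e, Measurable fun x : Fin n → ℝ => spikeEntries lam x e := fun e =>
    (measurable_pi_apply e).comp (measurable_spikeEntries lam)
  unfold shiftDensity
  fun_prop

lemma measurable_spikedDensity (lam : ℝ) (π : Measure ℝ) [IsProbabilityMeasure π] :
    Measurable (spikedDensity (n := n) lam π) := by
  have h := (measurable_shiftDensity_spikeEntries (n := n) lam).lintegral_prod_left'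
    (μ := Measure.pi fun _ => π)
  exact h.comp continuous_pairEntries.measurable

/-- Cameron–Martin applies for each fixed `x`; Tonelli then averages the shift densities over the
prior. -/
lemma spikedWigner_eq_withDensity (lam : ℝ) (π : Measure ℝ) [IsProbabilityMeasure π] (n : ℕ) :
    spikedWigner lam π n = (goe n).withDensity (spikedDensity lam π) := by
  ext A hA
  have hAm : Measurable (A.indicator (1 : Mat n → ℝ≥0∞)) := measurable_one.indicator hA
  have hind : Measurable fun w : Sym2 (Fin n) → ℝ => A.indicator (1 : Mat n → ℝ≥0∞) (symMat w) :=
    hAm.comp measurable_symMat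
  have hadd : Measurable fun xW : (Fin n → ℝ) × Mat n =>
      A.indicator (1 : Mat n → ℝ≥0∞) (lam • spike xW.1 + xW.2) :=
    hAm.comp (measurable_spike_add lam)
  rw [withDensity_apply _ hA, ← lintegral_indicator hA, ← lintegral_indicator_one hA, spikedWigner,
    lintegral_map hAm (measurable_spike_add lam),
    lintegral_prod _ hadd.aemeasurable]
  have h1 : ∀ x : Fin n → ℝ,
      ∫⁻ W, A.indicator (1 : Mat n → ℝ≥0∞) (lam • spike x + W) ∂(goe n)
        = ∫⁻ w, ENNReal.ofReal (shiftDensity (entryVar n) (spikeEntries lam x) w)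
          * A.indicator (1 : Mat n → ℝ≥0∞) (symMat w) ∂(goeEntries n) := by
    intro x
    have hx : Measurable fun W : Mat n => A.indicator (1 : Mat n → ℝ≥0∞) (lam • spike x + W) :=
      hAm.comp (measurable_const_add _)
    rw [goe_eq_map, lintegral_map hx measurable_symMat,
      goeEntries, ← lintegral_pi_gaussianReal_add entryVar_ne_zero _ hind]
    refine lintegral_congr fun w => ?_
    rw [smul_spike_eq_symMat]
    rfl
  simp_rw [h1]
  rw [lintegral_lintegral_swap, goe_eq_map,
    lintegral_map ((measurable_spikedDensity lam π).indicator hA) measurable_symMat]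
  · refine lintegral_congr fun w => ?_
    have hw : Measurable fun x : Fin n → ℝ =>
        ENNReal.ofReal (shiftDensity (entryVar n) (spikeEntries lam x) w) :=
      (measurable_shiftDensity_spikeEntries lam).of_uncurry_right
        (f := fun x w => ENNReal.ofReal (shiftDensity (entryVar n) (spikeEntries lam x) w))
    rw [lintegral_mul_const _ hw]
    by_cases hwA : symMat w ∈ A
    · simp only [hwA, Set.indicator_of_mem, Pi.one_apply, mul_one, spikedDensity,
        pairEntries_symMat]
    · simp only [hwA, not_false_eq_true, Set.indicator_of_notMem, mul_zero]
  · have hind' : Measurable fun xw : (Fin n → ℝ) × (Sym2 (Fin n) → ℝ) =>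
        A.indicator (1 : Mat n → ℝ≥0∞) (symMat xw.2) := hind.comp measurable_snd
    exact ((measurable_shiftDensity_spikeEntries lam).mul hind').aemeasurable

lemma spikedWigner_absolutelyContinuous (lam : ℝ) (π : Measure ℝ) [IsProbabilityMeasure π]
    (n : ℕ) : spikedWigner lam π n ≪ spikedWigner 0 π n := by
  rw [spikedWigner_zero, spikedWigner_eq_withDensity]
  exact withDensity_absolutelyContinuous _ _

/-- A product of exponentials that dominates the likelihood ratio. -/
noncomputable def densityBound (lam : ℝ) (w : Sym2 (Fin n) → ℝ) : ℝ :=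
  ∏ e, Real.exp (|lam| / entryVar n e * |w e|)

/-- The quadratic term in the exponent has a favourable sign and is dropped, while the linear one is
bounded independently of `x`. The bound is a product of exponentials of single entries, hence
square-integrable. -/
lemma spikedDensity_le (lam : ℝ) (π : Measure ℝ) [IsProbabilityMeasure π] (Y : Mat n) :
    spikedDensity lam π Y ≤ ENNReal.ofReal (densityBound lam (pairEntries Y)) := by
  have h : ∀ x : Fin n → ℝ, ENNReal.ofReal
      (shiftDensity (entryVar n) (spikeEntries lam x) (pairEntries Y))
        ≤ ENNReal.ofReal (densityBound lam (pairEntries Y)) := by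
    intro x
    refine ENNReal.ofReal_le_ofReal (Finset.prod_le_prod (fun _ _ => (Real.exp_pos _).le)
      fun e _ => Real.exp_le_exp.2 ?_)
    have h1 : spikeEntries lam x e * pairEntries Y e ≤ |lam| * |pairEntries Y e| :=
      (le_abs_self _).trans (by
        rw [abs_mul]
        exact mul_le_mul_of_nonneg_right (abs_spikeEntries_le lam x e) (abs_nonneg _))
    have h2 : 0 ≤ spikeEntries lam x e ^ 2 / (2 * (entryVar n e : ℝ)) := by positivity
    have h3 := div_le_div_of_nonneg_right h1 (entryVar n e).coe_nonneg
    rw [div_mul_eq_mul_div]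
    linarith
  refine (lintegral_mono h).trans ?_
  simp

lemma memLp_densityBound (lam : ℝ) : MemLp (densityBound (n := n) lam) 2 (goeEntries n) := by
  have hm : Measurable (densityBound (n := n) lam) := by unfold densityBound; fun_prop
  rw [memLp_two_iff_integrable_sq hm.aestronglyMeasurable]
  simp_rw [densityBound, ← Finset.prod_pow, ← Real.exp_nat_mul]
  refine Integrable.fintype_prod_dep (μ := fun e => gaussianReal 0 (entryVar n e))
    (f := fun e x => Real.exp (((2 : ℕ) : ℝ) * (|lam| / entryVar n e * |x|))) fun e => ?_
  simp_rw [← mul_assoc]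
  exact integrable_exp_mul_abs (X := fun x : ℝ => x) (integrable_exp_mul_gaussianReal _)
    (integrable_exp_mul_gaussianReal _)

lemma spikedLR_ae_eq (lam : ℝ) (π : Measure ℝ) [IsProbabilityMeasure π] (n : ℕ) :
    spikedLR lam π n =ᵐ[goe n] fun Y => (spikedDensity lam π Y).toReal := by
  have h := Measure.rnDeriv_withDensity (goe n) (measurable_spikedDensity (n := n) lam π)
  filter_upwards [h] with Y hY
  rw [spikedLR, likelihoodRatio, spikedWigner_zero, spikedWigner_eq_withDensity, hY]

lemma memLp_spikedLR (lam : ℝ) (π : Measure ℝ) [IsProbabilityMeasure π] (n : ℕ) :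
    MemLp (spikedLR lam π n) 2 (spikedWigner 0 π n) := by
  rw [spikedWigner_zero]
  have hb : MemLp (fun Y : Mat n => densityBound lam (pairEntries Y)) 2 (goe n) := by
    have hm : Measurable (fun Y : Mat n => densityBound lam (pairEntries Y)) := by
      unfold densityBound; fun_prop
    rw [goe_eq_map, memLp_map_measure_iff hm.aestronglyMeasurable measurable_symMat.aemeasurable]
    have : (fun Y : Mat n => densityBound lam (pairEntries Y)) ∘ symMat = densityBound lam := by
      ext w
      simp [pairEntries_symMat]
    rw [this]
    exact memLp_densityBound lam
  refine hb.mono' (Measure.measurable_rnDeriv _ _).ennreal_toReal.aestronglyMeasurable ?_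
  filter_upwards [spikedLR_ae_eq lam π n] with Y hY
  rw [hY, Real.norm_of_nonneg ENNReal.toReal_nonneg]
  exact ENNReal.toReal_le_of_le_ofReal (Finset.prod_nonneg fun _ _ => (Real.exp_pos _).le)
    (spikedDensity_le lam π Y)

end MatrixLaw

/-! ### The low-degree norm as a series in the overlap of two independent spikes -/

section Projection

variable {n : ℕ}

/-- The Hermite products, as functions of the matrix. -/
noncomputable def matHermite (k : Sym2 (Fin n) → ℕ) (Y : Mat n) : ℝ :=
  hermiteProd (entryVar n) k (pairEntries Y)

@[fun_prop]
lemma continuous_matHermite (k : Sym2 (Fin n) → ℕ) : Continuous (matHermite k) := by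
  unfold matHermite; fun_prop

lemma integral_goe {f : Mat n → ℝ} (hf : Continuous f) :
    ∫ Y, f Y ∂(goe n) = ∫ w, f (symMat w) ∂(goeEntries n) := by
  rw [goe_eq_map, integral_map measurable_symMat.aemeasurable
    hf.measurable.aestronglyMeasurable]

lemma memLp_matHermite (k : Sym2 (Fin n) → ℕ) : MemLp (matHermite k) 2 (goe n) := by
  have hc : Continuous fun Y => matHermite k Y ^ 2 := by fun_prop
  rw [memLp_two_iff_integrable_sq (continuous_matHermite k).measurable.aestronglyMeasurable,
    goe_eq_map, integrable_map_measure hc.measurable.aestronglyMeasurable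
      measurable_symMat.aemeasurable]
  refine (integrable_hermiteProd_mul (entryVar n) k k).congr (ae_of_all _ fun w => ?_)
  simp [matHermite, pairEntries_symMat, sq]

lemma integral_matHermite_mul (j k : Sym2 (Fin n) → ℕ) :
    ∫ Y, matHermite j Y * matHermite k Y ∂(goe n)
      = if j = k then ∏ e, ((k e).factorial : ℝ) else 0 := by
  rw [integral_goe (by fun_prop), ← integral_hermiteProd_mul entryVar_ne_zero]
  simp_rw [matHermite, pairEntries_symMat]
  rfl

lemma totalDegree_aeval_le {σ : Type*} (p : Polynomial ℝ) (q : MvPolynomial σ ℝ)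
    (hq : q.totalDegree ≤ 1) : (Polynomial.aeval q p).totalDegree ≤ p.natDegree := by
  rw [Polynomial.aeval_eq_sum_range]
  refine (MvPolynomial.totalDegree_finsetSum_le fun i hi => ?_)
  refine (MvPolynomial.totalDegree_smul_le _ _).trans ((MvPolynomial.totalDegree_pow _ _).trans ?_)
  have hi' := Finset.mem_range.1 hi
  nlinarith

/-- One inclusion between the span of the Hermite products and the low-degree polynomials: reading
each entry at a chosen ordered representative makes the product a polynomial in the matrix. -/
lemma exists_polyEval_eq_matHermite (k : Sym2 (Fin n) → ℕ) :
    ∃ p : MvPolynomial (Fin n × Fin n) ℝ, p.totalDegree ≤ ∑ e, k e ∧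
      matHermite k = polyEval p := by
  refine ⟨∏ e, Polynomial.aeval
    (MvPolynomial.C (√(entryVar n e : ℝ))⁻¹ * MvPolynomial.X (pairRep e)) (hermiteReal (k e)),
    ?_, ?_⟩
  · refine (MvPolynomial.totalDegree_finsetProd _ _).trans (Finset.sum_le_sum fun e _ => ?_)
    refine (totalDegree_aeval_le _ _ ?_).trans (natDegree_hermiteReal _).le
    refine (MvPolynomial.totalDegree_mul _ _).trans ?_
    simp
  · ext Y
    rw [matHermite, hermiteProd, polyEval, map_prod]
    refine Finset.prod_congr rfl fun e _ => ?_
    rw [hermiteScaled, ← MvPolynomial.coe_aeval_eq_eval, RingHom.coe_coe,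
      ← Polynomial.aeval_algHom_apply]
    simp [pairEntries, div_eq_inv_mul]

/-- The reverse inclusion, valid only on symmetric matrices: renaming identifies the variables `(i,
j)` and `(j, i)` without raising the degree. -/
lemma exists_polyEval_symMat_eq_sum {D : ℕ} (p : MvPolynomial (Fin n × Fin n) ℝ)
    (hp : p.totalDegree ≤ D) : ∃ a : (Sym2 (Fin n) → ℕ) → ℝ, ∀ w : Sym2 (Fin n) → ℝ,
      polyEval p (symMat w)
        = ∑ k ∈ multiIndices (Sym2 (Fin n)) D, a k * matHermite k (symMat w) := by
  obtain ⟨a, ha⟩ := exists_eval_eq_sum_hermiteProd (v := entryVar n) entryVar_ne_zero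
    (MvPolynomial.rename (fun ij : Fin n × Fin n => s(ij.1, ij.2)) p)
    ((MvPolynomial.totalDegree_rename_le _ _).trans hp)
  refine ⟨a, fun w => ?_⟩
  have h := ha w
  rw [MvPolynomial.eval_rename] at h
  simp_rw [matHermite, pairEntries_symMat]
  exact h

/-- The coefficients of the likelihood ratio in the Hermite basis. -/
lemma integral_matHermite_mul_spikedLR (lam : ℝ) (π : Measure ℝ) [IsProbabilityMeasure π]
    (k : Sym2 (Fin n) → ℕ) :
    ∫ Y, matHermite k Y * spikedLR lam π n Y ∂(goe n)
      = ∫ x : Fin n → ℝ, ∏ e, (spikeEntries lam x e / √(entryVar n e : ℝ)) ^ k e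
          ∂(Measure.pi fun _ => π) := by
  have hac := spikedWigner_absolutelyContinuous lam π n
  have hL := memLp_spikedLR lam π n
  rw [spikedWigner_zero] at hac hL
  have hint : Integrable (matHermite k) (spikedWigner lam π n) := by
    rw [← integrable_rnDeriv_smul_iff hac]
    have h := hL.integrable_mul (memLp_matHermite k)
    refine h.congr (ae_of_all _ fun Y => ?_)
    simp [spikedLR, likelihoodRatio, spikedWigner_zero]
  have h1 : ∫ Y, matHermite k Y * spikedLR lam π n Y ∂(goe n)
      = ∫ Y, matHermite k Y ∂(spikedWigner lam π n) := by
    rw [← integral_rnDeriv_smul hac]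
    refine integral_congr_ae (ae_of_all _ fun Y => ?_)
    simp [spikedLR, likelihoodRatio, spikedWigner_zero, mul_comm]
  have hm : AEMeasurable (fun xW : (Fin n → ℝ) × Mat n => lam • spike xW.1 + xW.2)
      ((Measure.pi fun _ : Fin n => π).prod (goe n)) := (measurable_spike_add lam).aemeasurable
  have hsm : Measurable (matHermite k) := (continuous_matHermite k).measurable
  rw [h1, spikedWigner, integral_map hm hsm.aestronglyMeasurable, integral_prod]
  · refine integral_congr_ae (ae_of_all _ fun x => ?_)
    have hc : Continuous fun W : Mat n => matHermite k (lam • spike x + W) := by fun_prop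
    simp only
    rw [integral_goe hc, ← integral_hermiteProd_add entryVar_ne_zero]
    refine integral_congr_ae (ae_of_all _ fun w => ?_)
    simp only [smul_spike_eq_symMat]
    rw [matHermite, ← pairEntries_symMat (spikeEntries lam x + w)]
    rfl
  · exact (integrable_map_measure hsm.aestronglyMeasurable hm).1 hint

lemma norm_lowDegreePart_sq_eq_sum_multiIndices (lam : ℝ) (π : Measure ℝ)
    [IsProbabilityMeasure π] (D : ℕ) (hL : MemLp (spikedLR lam π n) 2 (spikedWigner 0 π n)) :
    ‖lowDegreePart (spikedWigner 0 π n) D (spikedLR lam π n) hL‖ ^ 2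
      = ∑ k ∈ multiIndices (Sym2 (Fin n)) D,
          (∫ x : Fin n → ℝ, ∏ e, (spikeEntries lam x e / √(entryVar n e : ℝ)) ^ k e
            ∂(Measure.pi fun _ => π)) ^ 2 / ∏ e, ((k e).factorial : ℝ) := by
  revert hL
  generalize hQ : spikedWigner 0 π n = Q
  rw [spikedWigner_zero] at hQ
  subst hQ
  intro hL
  rw [lowDegreePart, norm_starProjection_sq_eq_sum (lowDegree (goe n) D)
    (multiIndices (Sym2 (Fin n)) D) (fun k => (memLp_matHermite k).toLp (matHermite k))
    (fun k => ∏ e, ((k e).factorial : ℝ))]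
  · refine Finset.sum_congr rfl fun k _ => ?_
    congr 2
    rw [L2.inner_def, ← integral_matHermite_mul_spikedLR]
    refine integral_congr_ae ?_
    filter_upwards [(memLp_matHermite k).coeFn_toLp, hL.coeFn_toLp] with Y h1 h2
    rw [h1, h2]
    simp [mul_comm]
  · intro k _
    exact Finset.prod_ne_zero_iff.2 fun e _ => by positivity
  · intro j _ k _
    rw [L2.inner_def, ← integral_matHermite_mul]
    refine integral_congr_ae ?_
    filter_upwards [(memLp_matHermite j).coeFn_toLp, (memLp_matHermite k).coeFn_toLp] with Y h1 h2
    rw [h1, h2]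
    simp [mul_comm]
  · intro k hk
    obtain ⟨p, hp, hpk⟩ := exists_polyEval_eq_matHermite k
    refine ⟨p, hp.trans (mem_multiIndices.1 hk), ?_⟩
    rw [← hpk]
    exact (memLp_matHermite k).coeFn_toLp
  · rintro f ⟨p, hp, hf⟩
    obtain ⟨a, ha⟩ := exists_polyEval_symMat_eq_sum p hp
    refine ⟨a, Lp.ext ?_⟩
    -- The identity is known only on symmetric matrices, which carry all the mass of `goe n`.
    have hpoly : polyEval p =ᵐ[goe n]
        fun Y => ∑ k ∈ multiIndices (Sym2 (Fin n)) D, a k * matHermite k Y := by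
      have hpc : Continuous (polyEval p) := by
        unfold polyEval
        exact (MvPolynomial.continuous_eval p).comp (by fun_prop)
      have hms : MeasurableSet {Y : Mat n |
          polyEval p Y = ∑ k ∈ multiIndices (Sym2 (Fin n)) D, a k * matHermite k Y} :=
        (isClosed_eq hpc (by fun_prop)).measurableSet
      rw [goe_eq_map, Filter.EventuallyEq, ae_map_iff measurable_symMat.aemeasurable hms]
      exact ae_of_all _ ha
    have hsum := Lp.coeFn_finsetSum (multiIndices (Sym2 (Fin n)) D)
      (fun k => a k • (memLp_matHermite k).toLp (matHermite k))
    have hterm : ∀ᵐ Y ∂(goe n), ∀ k ∈ multiIndices (Sym2 (Fin n)) D,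
        (a k • (memLp_matHermite k).toLp (matHermite k) : Lp ℝ 2 (goe n)) Y
          = a k * matHermite k Y := by
      rw [Filter.eventually_all_finset]
      intro k _
      filter_upwards [Lp.coeFn_smul (a k) ((memLp_matHermite k).toLp (matHermite k)),
        (memLp_matHermite k).coeFn_toLp] with Y h1 h2
      rw [h1, Pi.smul_apply, h2, smul_eq_mul]
    filter_upwards [hf, hpoly, hsum, hterm] with Y h1 h2 h3 h4
    rw [h1, h2, h3, Finset.sum_apply]
    exact Finset.sum_congr rfl fun k hk => (h4 k hk).symm

/-- The squared cosine of the angle between two vectors (zero if one of them vanishes). -/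
noncomputable def overlap (x y : Fin n → ℝ) : ℝ :=
  (∑ i, x i * y i) ^ 2 / ((∑ i, x i ^ 2) * ∑ i, y i ^ 2)

/-- The weights count the ordered pairs above an unordered one. -/
lemma sum_prod_eq_sum_sym2 {ι : Type*} [Fintype ι] [DecidableEq ι] (F : Sym2 ι → ℝ) :
    ∑ i, ∑ j, F s(i, j) = ∑ e, (if e.IsDiag then 1 else 2) * F e := by
  rw [← Finset.sum_product', Finset.univ_product_univ,
    ← Finset.sum_fiberwise (s := Finset.univ) (g := fun ij : ι × ι => s(ij.1, ij.2))]
  refine Finset.sum_congr rfl fun e _ => ?_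
  rw [Finset.sum_congr rfl (g := fun _ => F e) fun ij hij => by
    rw [(Finset.mem_filter.1 hij).2], Finset.sum_const, nsmul_eq_mul]
  congr 1
  induction e with
  | _ i j =>
    have h : (Finset.univ.filter fun ij : ι × ι => s(ij.1, ij.2) = s(i, j)) = {(i, j), (j, i)} := by
      ext ⟨a, b⟩
      simp
    rw [h]
    by_cases hij : i = j
    · subst hij
      simp
    · rw [Finset.card_pair (by simp [hij])]
      simp [hij]

/-- The doubled variance on the diagonal exactly matches its being counted once rather than twice
among ordered pairs. The weighted inner product is thus `n / 2` times the Frobenius inner product of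
the two signal matrices, which is a squared cosine. -/
lemma sum_spikeEntries_mul (lam : ℝ) (x y : Fin n → ℝ) :
    ∑ e, (spikeEntries lam x e / √(entryVar n e : ℝ)) * (spikeEntries lam y e / √(entryVar n e : ℝ))
      = lam ^ 2 / 2 * (n * overlap x y) := by
  have h1 : ∀ e : Sym2 (Fin n),
      (spikeEntries lam x e / √(entryVar n e : ℝ)) * (spikeEntries lam y e / √(entryVar n e : ℝ))
        = (if e.IsDiag then 1 else 2) * (n / 2 * (spikeEntries lam x e * spikeEntries lam y e)) := by
    intro e
    rw [div_mul_div_comm, Real.mul_self_sqrt (entryVar n e).coe_nonneg, entryVar]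
    split_ifs
    · push_cast
      rw [div_div_eq_mul_div]
      ring
    · push_cast
      rw [div_div_eq_mul_div]
      ring
  simp_rw [h1]
  rw [← sum_prod_eq_sum_sym2]
  have h2 : ∀ i j, (n / 2 : ℝ) * (spikeEntries lam x s(i, j) * spikeEntries lam y s(i, j))
      = (n / 2 * lam ^ 2 / ((∑ k, x k ^ 2) * ∑ k, y k ^ 2)) * ((x i * y i) * (x j * y j)) := by
    intro i j
    simp only [spikeEntries, Sym2.lift_mk, spike]
    rw [div_mul_eq_mul_div, div_eq_mul_inv (x i * x j), div_eq_mul_inv (y i * y j),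
      div_eq_mul_inv _ ((∑ k, x k ^ 2) * _), mul_inv]
    ring
  simp_rw [h2, ← Finset.mul_sum, ← Finset.sum_mul]
  rw [overlap]
  ring

lemma measurable_overlap :
    Measurable fun xy : (Fin n → ℝ) × (Fin n → ℝ) => overlap xy.1 xy.2 := by
  unfold overlap
  fun_prop

/-- The low-degree norm of the likelihood ratio in terms of two independent copies of the spike. -/
lemma norm_lowDegreePart_sq (lam : ℝ) (π : Measure ℝ) [IsProbabilityMeasure π] (D : ℕ)
    (hL : MemLp (spikedLR lam π n) 2 (spikedWigner 0 π n)) :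
    ‖lowDegreePart (spikedWigner 0 π n) D (spikedLR lam π n) hL‖ ^ 2
      = ∑ d ∈ Finset.range (D + 1), (lam ^ 2 / 2) ^ d / d.factorial *
          ∫ xy, (n * overlap xy.1 xy.2) ^ d
            ∂((Measure.pi fun _ : Fin n => π).prod (Measure.pi fun _ : Fin n => π)) := by
  rw [norm_lowDegreePart_sq_eq_sum_multiIndices, sum_multiIndices]
  refine Finset.sum_congr rfl fun d _ => ?_
  set a : (Fin n → ℝ) → Sym2 (Fin n) → ℝ := fun x e => spikeEntries lam x e / √(entryVar n e : ℝ)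
    with ha
  have hameas : ∀ e, Measurable fun x => a x e := fun e =>
    ((measurable_pi_apply e).comp (measurable_spikeEntries lam)).div_const _
  have habs : ∀ x e, |a x e| ≤ |lam| / √(entryVar n e : ℝ) := by
    intro x e
    rw [ha, abs_div, abs_of_nonneg (Real.sqrt_nonneg _)]
    exact div_le_div_of_nonneg_right (abs_spikeEntries_le lam x e) (Real.sqrt_nonneg _)
  have hint : ∀ k : Sym2 (Fin n) → ℕ, Integrable (fun x => ∏ e, a x e ^ k e)
      (Measure.pi fun _ : Fin n => π) := by
    intro k
    refine Integrable.of_bound (C := ∏ e, (|lam| / √(entryVar n e : ℝ)) ^ k e)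
      (Finset.measurable_prod _ fun e _ => (hameas e).pow_const _).aestronglyMeasurable
      (ae_of_all _ fun x => ?_)
    rw [Real.norm_eq_abs, Finset.abs_prod]
    refine Finset.prod_le_prod (fun _ _ => abs_nonneg _) fun e _ => ?_
    rw [abs_pow]
    exact pow_le_pow_left₀ (abs_nonneg _) (habs x e) _
  -- The square of an expectation is an expectation over two independent copies of the spike.
  have hsq : ∀ k : Sym2 (Fin n) → ℕ,
      (∫ x, ∏ e, a x e ^ k e ∂(Measure.pi fun _ : Fin n => π)) ^ 2
        = ∫ xy, ∏ e, (a xy.1 e * a xy.2 e) ^ k e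
          ∂((Measure.pi fun _ : Fin n => π).prod (Measure.pi fun _ : Fin n => π)) := by
    intro k
    rw [sq, ← integral_prod_mul]
    simp_rw [← Finset.prod_mul_distrib, ← mul_pow]
  have hint2 : ∀ k : Sym2 (Fin n) → ℕ, Integrable
      (fun xy : (Fin n → ℝ) × (Fin n → ℝ) => ∏ e, (a xy.1 e * a xy.2 e) ^ k e)
      ((Measure.pi fun _ : Fin n => π).prod (Measure.pi fun _ : Fin n => π)) := by
    intro k
    refine ((hint k).mul_prod (hint k)).congr (ae_of_all _ fun xy => ?_)
    simp only [Finset.prod_mul_distrib, mul_pow]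
  have hterm : ∀ k : Sym2 (Fin n) → ℕ,
      (∫ x, ∏ e, a x e ^ k e ∂(Measure.pi fun _ : Fin n => π)) ^ 2 / ∏ e, ((k e).factorial : ℝ)
        = ∫ xy, (∏ e, (a xy.1 e * a xy.2 e) ^ k e) / ∏ e, ((k e).factorial : ℝ)
          ∂((Measure.pi fun _ : Fin n => π).prod (Measure.pi fun _ : Fin n => π)) := by
    intro k
    rw [hsq, integral_div]
  refine (Finset.sum_congr rfl fun k _ => hterm k).trans ?_
  rw [← integral_finsetSum _ fun k _ => (hint2 k).div_const _, ← integral_const_mul]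
  refine integral_congr_ae (ae_of_all _ fun xy => ?_)
  simp only
  rw [sum_piAntidiag_div_factorial, sum_spikeEntries_mul]
  ring

end Projection

/-! ### Exponential moments and behaviour of the cumulant generating function near zero -/

section ExponentialMoments

lemma gaussianPDFReal_mul_exp_sq (b x : ℝ) :
    gaussianPDFReal 0 1 x * Real.exp (b * x ^ 2)
      = (√(2 * Real.pi))⁻¹ * Real.exp (-(1 / 2 - b) * x ^ 2) := by
  rw [gaussianPDFReal, mul_assoc, ← Real.exp_add]
  simp only [NNReal.coe_one, mul_one, sub_zero]
  congr 2
  ring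

lemma integrable_exp_sq_gaussianReal {b : ℝ} (hb : b < 1 / 2) :
    Integrable (fun x => Real.exp (b * x ^ 2)) (gaussianReal 0 1) := by
  rw [gaussianReal_of_var_ne_zero _ one_ne_zero,
    integrable_withDensity_iff_integrable_smul' (measurable_gaussianPDF _ _)
      (ae_of_all _ fun x => gaussianPDF_lt_top)]
  simp_rw [toReal_gaussianPDF, smul_eq_mul, gaussianPDFReal_mul_exp_sq]
  exact (integrable_exp_neg_mul_sq (by linarith)).const_mul _

lemma integral_exp_sq_gaussianReal {b : ℝ} (hb : b < 1 / 2) :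
    ∫ x, Real.exp (b * x ^ 2) ∂(gaussianReal 0 1) = (1 - 2 * b) ^ (-(1 / 2) : ℝ) := by
  rw [integral_gaussianReal_eq_integral_smul one_ne_zero]
  simp_rw [smul_eq_mul, gaussianPDFReal_mul_exp_sq]
  have hpos : 0 < 1 - 2 * b := by linarith
  rw [integral_const_mul, integral_gaussian, Real.rpow_neg hpos.le, ← Real.sqrt_eq_rpow,
    ← Real.sqrt_inv, ← Real.sqrt_inv, ← Real.sqrt_mul (by positivity)]
  congr 1
  have h1 : 1 / 2 - b ≠ 0 := by linarith
  field_simp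

lemma IsSpikePrior.integrable_pow {π : Measure ℝ} (hπ : IsSpikePrior π) (k : ℕ) :
    Integrable (fun x => x ^ k) π := by
  obtain ⟨c, -, h⟩ := hπ.subgaussian
  have hu : integrableExpSet (fun x : ℝ => x) π = Set.univ :=
    Set.eq_univ_of_forall fun t => (h t).1
  exact integrable_pow_of_mem_interior_integrableExpSet (X := fun x => x) (by simp [hu]) k

variable {π : Measure ℝ} [IsProbabilityMeasure π]

/-- A subgaussian law has finite exponential moments of its square. -/
lemma IsSpikePrior.exists_integrable_exp_sq (hπ : IsSpikePrior π) :
    ∃ s : ℝ, 0 < s ∧ Integrable (fun x => Real.exp (s * x ^ 2)) π := by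
  obtain ⟨c, hc, h⟩ := hπ.subgaussian
  -- Linearise the square with an auxiliary standard Gaussian `g`: `exp(r² x² / 2) = E[exp(r x g)]`.
  -- Integrating over `x` first gives at most `exp(c r² g²)`. With `r² = 1 / (4c)` this is `exp(g² /
  -- 4)`, below the integrability threshold `1 / 2`.
  refine ⟨1 / (8 * c), by positivity, ?_⟩
  set r : ℝ := √(2 * (1 / (8 * c))) with hr
  have hr2 : r ^ 2 = 1 / (4 * c) := by
    rw [hr, Real.sq_sqrt (by positivity)]
    field_simp
    norm_num
  refine ⟨by fun_prop, ?_⟩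
  rw [hasFiniteIntegral_iff_ofReal (ae_of_all _ fun x => (Real.exp_pos _).le)]
  have h1 : ∀ x : ℝ, ENNReal.ofReal (Real.exp (1 / (8 * c) * x ^ 2))
      = ∫⁻ g, ENNReal.ofReal (Real.exp (r * x * g)) ∂(gaussianReal 0 1) := by
    intro x
    rw [← ofReal_integral_eq_lintegral_ofReal (integrable_exp_mul_gaussianReal _)
      (ae_of_all _ fun _ => (Real.exp_pos _).le)]
    have hm := mgf_gaussianReal (p := gaussianReal 0 1) (X := id) Measure.map_id (r * x)
    simp only [mgf, id] at hm
    rw [hm]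
    congr 2
    rw [mul_pow, hr2, NNReal.coe_one]
    field_simp
    ring
  simp_rw [h1]
  rw [lintegral_lintegral_swap (by fun_prop)]
  have h2 : ∀ g : ℝ, ∫⁻ x, ENNReal.ofReal (Real.exp (r * x * g)) ∂π
      ≤ ENNReal.ofReal (Real.exp (1 / 4 * g ^ 2)) := by
    intro g
    have e : ∀ x, r * x * g = r * g * x := fun x => by ring
    simp_rw [e]
    rw [← ofReal_integral_eq_lintegral_ofReal (h (r * g)).1
      (ae_of_all _ fun _ => (Real.exp_pos _).le)]
    refine ENNReal.ofReal_le_ofReal ((h (r * g)).2.trans (Real.exp_le_exp.2 (le_of_eq ?_)))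
    rw [mul_pow, hr2]
    field_simp
  refine (lintegral_mono h2).trans_lt ?_
  have h3 := (integrable_exp_sq_gaussianReal (b := 1 / 4) (by norm_num)).2
  rwa [hasFiniteIntegral_iff_ofReal (ae_of_all _ fun x => (Real.exp_pos _).le)] at h3

lemma mem_interior_integrableExpSet_of_forall_abs_le {Ω : Type*} {m : MeasurableSpace Ω}
    {X : Ω → ℝ} {P : Measure Ω} {s : ℝ} (hs : 0 < s)
    (h : ∀ t, |t| ≤ s → Integrable (fun ω => Real.exp (t * X ω)) P) :
    0 ∈ interior (integrableExpSet X P) := by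
  rw [mem_interior_iff_mem_nhds]
  filter_upwards [Icc_mem_nhds (a := -s) (b := s) (by linarith) hs] with t ht
  exact h t (abs_le.2 ht)

/-- A product is dominated by the sum of the squares, whose exponential moments factor. The values
`σ = 1` and `σ = -1` serve the two tails of the inner product. -/
lemma IsSpikePrior.mem_interior_mul (hπ : IsSpikePrior π) (σ : ℝ) (hσ : |σ| ≤ 1) :
    0 ∈ interior (integrableExpSet (fun p : ℝ × ℝ => σ * (p.1 * p.2)) (π.prod π)) := by
  obtain ⟨s, hs, hint⟩ := hπ.exists_integrable_exp_sq
  refine mem_interior_integrableExpSet_of_forall_abs_le hs fun t ht => ?_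
  refine (hint.mul_prod hint).mono' (by fun_prop) (ae_of_all _ fun p => ?_)
  rw [Real.norm_of_nonneg (Real.exp_pos _).le, ← Real.exp_add]
  refine Real.exp_le_exp.2 ?_
  have h1 : t * (σ * (p.1 * p.2)) ≤ |t| * (|σ| * (|p.1| * |p.2|)) := by
    rw [← abs_mul, ← abs_mul, ← abs_mul]; exact le_abs_self _
  have h2 : |t| * (|σ| * (|p.1| * |p.2|)) ≤ s * (1 * (|p.1| * |p.2|)) := by gcongr
  have h3 : |p.1| * |p.2| ≤ p.1 ^ 2 + p.2 ^ 2 := by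
    rw [← sq_abs p.1, ← sq_abs p.2]
    nlinarith [sq_nonneg (|p.1| - |p.2|), sq_nonneg |p.1|, sq_nonneg |p.2|]
  nlinarith

lemma IsSpikePrior.mem_interior_one_sub_sq (hπ : IsSpikePrior π) :
    0 ∈ interior (integrableExpSet (fun x : ℝ => 1 - x ^ 2) π) := by
  obtain ⟨s, hs, hint⟩ := hπ.exists_integrable_exp_sq
  refine mem_interior_integrableExpSet_of_forall_abs_le hs fun t ht => ?_
  refine (hint.const_mul (Real.exp s)).mono' (by fun_prop) (ae_of_all _ fun x => ?_)
  rw [Real.norm_of_nonneg (Real.exp_pos _).le, ← Real.exp_add]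
  refine Real.exp_le_exp.2 ?_
  nlinarith [(abs_le.1 ht).1, (abs_le.1 ht).2, sq_nonneg x]

variable {Ω : Type*} {mΩ : MeasurableSpace Ω} {X : Ω → ℝ} {P : Measure Ω} [IsProbabilityMeasure P]

/-- Near zero, the moment generating function of a standardized variable is almost subgaussian with
the optimal constant. -/
lemma exists_mgf_le_exp_sq (h : 0 ∈ interior (integrableExpSet X P)) (h0 : ∫ ω, X ω ∂P = 0)
    (h1 : ∫ ω, X ω ^ 2 ∂P = 1) {η : ℝ} (hη : 0 < η) :
    ∃ δ : ℝ, 0 < δ ∧ ∀ t ∈ Set.Icc 0 δ, Integrable (fun ω => Real.exp (t * X ω)) P ∧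
      mgf X P t ≤ Real.exp ((1 + η) * t ^ 2 / 2) := by
  -- The second derivative of the cumulant generating function is the variance `1` at zero, so it
  -- stays below `1 + η` nearby. Taylor's formula with vanishing zeroth and first order terms then
  -- gives the bound.
  have hcont : ContinuousAt (iteratedDeriv 2 (cgf X P)) 0 :=
    iteratedDeriv_eq_iterate (𝕜 := ℝ) (F := ℝ) ▸ ((analyticAt_cgf h).iterated_deriv 2).continuousAt
  have hval : iteratedDeriv 2 (cgf X P) 0 = 1 := by
    rw [iteratedDeriv_two_cgf h, deriv_cgf_zero h, h0]
    simp [h1]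
  have hev : ∀ᶠ t in 𝓝 (0 : ℝ), iteratedDeriv 2 (cgf X P) t < 1 + η :=
    hcont.eventually_lt continuousAt_const (by rw [hval]; linarith)
  have hint : ∀ᶠ t in 𝓝 (0 : ℝ), t ∈ interior (integrableExpSet X P) :=
    isOpen_interior.mem_nhds h
  obtain ⟨δ, hδ, hball⟩ := Metric.eventually_nhds_iff.1 (hev.and hint)
  have hmem : ∀ t ∈ Set.Icc (0 : ℝ) (δ / 2), dist t 0 < δ := by
    intro t ht
    rw [Real.dist_0_eq_abs, abs_of_nonneg ht.1]
    linarith [ht.2]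
  refine ⟨δ / 2, by linarith, fun t ht => ?_⟩
  have hti := (hball (hmem t ht)).2
  have hexp := interior_subset hti
  refine ⟨hexp, ?_⟩
  rcases ht.1.eq_or_lt with rfl | htpos
  · simp
  obtain ⟨u, hu, hcgf⟩ := exists_cgf_eq_iteratedDeriv_two_cgf_mul htpos h0 (fun r hr =>
    (hball (hmem r ⟨hr.1, hr.2.trans ht.2⟩)).2)
  rw [← exp_cgf hexp, hcgf]
  refine Real.exp_le_exp.2 ?_
  have := (hball (hmem u ⟨hu.1.le, hu.2.le.trans ht.2⟩)).1
  nlinarith [sq_nonneg t]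

/-- A centered variable with exponential moments has sublinear cumulant generating function near
zero. -/
lemma exists_mgf_le_exp_mul (h : 0 ∈ interior (integrableExpSet X P)) (h0 : ∫ ω, X ω ∂P = 0)
    {η : ℝ} (hη : 0 < η) :
    ∃ t : ℝ, 0 < t ∧ Integrable (fun ω => Real.exp (t * X ω)) P ∧ mgf X P t ≤ Real.exp (η * t) := by
  have hd : HasDerivAt (cgf X P) 0 0 := by
    have := (analyticAt_cgf h).differentiableAt.hasDerivAt
    rwa [deriv_cgf_zero h, h0, probReal_univ, zero_div] at this
  have hev := hd.isLittleO.def hη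
  have hint : ∀ᶠ t in 𝓝 (0 : ℝ), t ∈ interior (integrableExpSet X P) :=
    isOpen_interior.mem_nhds h
  obtain ⟨δ, hδ, hball⟩ := Metric.eventually_nhds_iff.1 (hev.and hint)
  have hmem : dist (δ / 2) 0 < δ := by
    rw [Real.dist_0_eq_abs, abs_of_nonneg (by linarith)]
    linarith
  obtain ⟨hb, hti⟩ := hball hmem
  have hexp := interior_subset hti
  refine ⟨δ / 2, by linarith, hexp, ?_⟩
  rw [← exp_cgf hexp]
  refine Real.exp_le_exp.2 ?_
  simp only [cgf_zero, sub_zero, smul_zero, Real.norm_eq_abs, abs_of_pos (half_pos hδ)] at hb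
  exact (le_abs_self _).trans hb

end ExponentialMoments

/-! ### Both spikes on one probability space; moments of the inner product and tails of the norms -/

section PairSequence

/-- The law of an i.i.d. sequence of pairs of independent draws from `π`. -/
noncomputable def pairSeq (π : Measure ℝ) [IsProbabilityMeasure π] : Measure (ℕ → ℝ × ℝ) :=
  Measure.infinitePi fun _ => π.prod π

variable (π : Measure ℝ) [IsProbabilityMeasure π]

instance : IsProbabilityMeasure (pairSeq π) := by unfold pairSeq; infer_instance

/-- The partial sums of a function along a sequence of pairs. -/
def pairSum (f : ℝ × ℝ → ℝ) (n : ℕ) (ω : ℕ → ℝ × ℝ) : ℝ := ∑ i ∈ Finset.range n, f (ω i)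

lemma measurable_pairSum {f : ℝ × ℝ → ℝ} (hf : Measurable f) (n : ℕ) :
    Measurable (pairSum f n) := by
  unfold pairSum; fun_prop

lemma iIndepFun_pairSeq {f : ℝ × ℝ → ℝ} (hf : Measurable f) :
    iIndepFun (fun i (ω : ℕ → ℝ × ℝ) => f (ω i)) (pairSeq π) :=
  iIndepFun_infinitePi (X := fun _ => f) fun _ => hf

lemma map_eval_pairSeq (i : ℕ) : (pairSeq π).map (fun ω => ω i) = π.prod π :=
  Measure.infinitePi_map_eval _ i

lemma integral_comp_pairSeq {f : ℝ × ℝ → ℝ} (hf : Measurable f) (i : ℕ) :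
    ∫ ω, f (ω i) ∂(pairSeq π) = ∫ p, f p ∂(π.prod π) := by
  rw [← map_eval_pairSeq π i, integral_map (measurable_pi_apply i).aemeasurable hf.aestronglyMeasurable]

lemma integrable_comp_pairSeq {f : ℝ × ℝ → ℝ} (hf : Integrable f (π.prod π)) (i : ℕ) :
    Integrable (fun ω : ℕ → ℝ × ℝ => f (ω i)) (pairSeq π) := by
  rw [← map_eval_pairSeq π i] at hf
  exact hf.comp_measurable (by fun_prop)

lemma identDistrib_pairSeq {f : ℝ × ℝ → ℝ} (hf : Measurable f) (i j : ℕ) :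
    IdentDistrib (fun ω : ℕ → ℝ × ℝ => f (ω i)) (fun ω => f (ω j)) (pairSeq π) (pairSeq π) := by
  have h : IdentDistrib (fun ω : ℕ → ℝ × ℝ => ω i) (fun ω => ω j) (pairSeq π) (pairSeq π) :=
    ⟨(measurable_pi_apply i).aemeasurable, (measurable_pi_apply j).aemeasurable,
      by rw [map_eval_pairSeq, map_eval_pairSeq]⟩
  exact h.comp hf

lemma mgf_comp_pairSeq {f : ℝ × ℝ → ℝ} (hf : Measurable f) (i : ℕ) (t : ℝ) :
    mgf (fun ω : ℕ → ℝ × ℝ => f (ω i)) (pairSeq π) t = mgf f (π.prod π) t :=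
  integral_comp_pairSeq π (f := fun p => Real.exp (t * f p)) (by fun_prop) i

lemma pairSum_eq_sum (f : ℝ × ℝ → ℝ) (n : ℕ) :
    pairSum f n = ∑ i ∈ Finset.range n, fun ω : ℕ → ℝ × ℝ => f (ω i) := by
  ext ω; simp [pairSum]

lemma mgf_pairSum {f : ℝ × ℝ → ℝ} (hf : Measurable f) (n : ℕ) (t : ℝ) :
    mgf (pairSum f n) (pairSeq π) t = mgf f (π.prod π) t ^ n := by
  rw [pairSum_eq_sum, (iIndepFun_pairSeq π hf).mgf_sum (fun i => by fun_prop)]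
  simp_rw [mgf_comp_pairSeq π hf]
  simp

lemma integrable_exp_mul_pairSum {f : ℝ × ℝ → ℝ} (hf : Measurable f) (n : ℕ) {t : ℝ}
    (h : Integrable (fun p => Real.exp (t * f p)) (π.prod π)) :
    Integrable (fun ω => Real.exp (t * pairSum f n ω)) (pairSeq π) := by
  rw [pairSum_eq_sum]
  exact (iIndepFun_pairSeq π hf).integrable_exp_mul_sum (fun i => by fun_prop)
    fun i _ => integrable_comp_pairSeq π h i

/-- The squared cosine of the angle between the first `n` terms of two sequences. -/
noncomputable def seqOverlap (n : ℕ) (ω : ℕ → ℝ × ℝ) : ℝ :=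
  pairSum (fun p => p.1 * p.2) n ω ^ 2
    / (pairSum (fun p => p.1 ^ 2) n ω * pairSum (fun p => p.2 ^ 2) n ω)

lemma measurable_seqOverlap (n : ℕ) : Measurable (seqOverlap n) := by
  unfold seqOverlap pairSum; fun_prop

lemma seqOverlap_nonneg (n : ℕ) (ω : ℕ → ℝ × ℝ) : 0 ≤ seqOverlap n ω := by
  unfold seqOverlap pairSum; positivity

lemma seqOverlap_le_one (n : ℕ) (ω : ℕ → ℝ × ℝ) : seqOverlap n ω ≤ 1 :=
  div_le_one_of_le₀ (Finset.sum_mul_sq_le_sq_mul_sq _ _ _) (by unfold pairSum; positivity)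

/-- Realises the two spikes of every dimension as initial segments of one i.i.d. sequence of pairs,
the setting in which the limit theorems apply. -/
lemma integral_overlap_eq_seqOverlap (n d : ℕ) :
    ∫ xy, (n * overlap xy.1 xy.2) ^ d
        ∂((Measure.pi fun _ : Fin n => π).prod (Measure.pi fun _ : Fin n => π))
      = ∫ ω, (n * seqOverlap n ω) ^ d ∂(pairSeq π) := by
  have h1 := measurePreserving_arrowProdEquivProdArrow ℝ ℝ (Fin n) (fun _ => π) (fun _ => π)
  have h2 : (pairSeq π).map (fun ω (i : Fin n) => ω i) = Measure.pi fun _ : Fin n => π.prod π := by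
    rw [← Measure.infinitePi_eq_pi]
    exact Measure.map_infinitePi_infinitePi_of_inj (P := fun _ : ℕ => π.prod π) Fin.val_injective
  have hm : Measurable fun xy : (Fin n → ℝ) × (Fin n → ℝ) => ((n : ℝ) * overlap xy.1 xy.2) ^ d :=
    (measurable_overlap.const_mul _).pow_const _
  have hm' : Measurable fun z : Fin n → ℝ × ℝ => ((n : ℝ) * overlap
      (MeasurableEquiv.arrowProdEquivProdArrow ℝ ℝ (Fin n) z).1
      (MeasurableEquiv.arrowProdEquivProdArrow ℝ ℝ (Fin n) z).2) ^ d :=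
    hm.comp (MeasurableEquiv.measurable _)
  rw [← h1.integral_comp', ← h2, integral_map (measurable_pi_lambda _ fun _ => measurable_pi_apply _).aemeasurable
     hm'.aestronglyMeasurable]
  refine integral_congr_ae (ae_of_all _ fun ω => ?_)
  simp only [overlap, seqOverlap, pairSum, Finset.sum_range]
  rfl

variable {π}

/-- Moments are bounded by exponential moments. -/
lemma pow_two_mul_le_exp {s : ℝ} (hs : 0 < s) (x : ℝ) (d : ℕ) :
    x ^ (2 * d) ≤ (2 * d).factorial / s ^ (2 * d) * (Real.exp (s * x) + Real.exp (s * -x)) := by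
  have h := Real.pow_div_factorial_le_exp |s * x| (abs_nonneg _) (2 * d)
  have h2 : Real.exp |s * x| ≤ Real.exp (s * x) + Real.exp (s * -x) := by
    rcases abs_cases (s * x) with ⟨h, -⟩ | ⟨h, -⟩ <;> rw [h]
    · linarith [Real.exp_pos (s * -x)]
    · rw [← mul_neg]; linarith [Real.exp_pos (s * x)]
  have h3 := h.trans h2
  rw [Even.pow_abs (even_two_mul d), mul_pow, div_le_iff₀ (by positivity)] at h3
  rw [div_mul_eq_mul_div, le_div_iff₀ (by positivity)]
  linarith

lemma factorial_two_mul_le (d : ℕ) :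
    ((2 * d).factorial : ℝ) ≤ 4 ^ d * (d.factorial : ℝ) * d.factorial := by
  have h := Nat.choose_mul_factorial_mul_factorial (n := 2 * d) (k := d) (by omega)
  rw [show 2 * d - d = d by omega] at h
  have h2 : (2 * d).choose d ≤ 4 ^ d := by
    have := Nat.choose_le_two_pow (2 * d) d
    rwa [pow_mul] at this
  rw [← h]
  push_cast
  gcongr
  exact_mod_cast h2

/-- A crude Stirling bound, by induction from `e ≤ (1 + 1/d)^(d+1)`. The loss is only a factor
linear in `d`, which geometric decay absorbs. -/
lemma factorial_mul_exp_le (d : ℕ) (hd : 1 ≤ d) :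
    (d.factorial : ℝ) * Real.exp d ≤ Real.exp 1 * d * (d : ℝ) ^ d := by
  induction d, hd using Nat.le_induction with
  | base => simp
  | succ d hd ih =>
    have hd0 : (0 : ℝ) < d := by exact_mod_cast hd
    have hkey : Real.exp 1 * (d * (d : ℝ) ^ d) ≤ ((d : ℝ) + 1) ^ (d + 1) := by
      have hlog : 1 ≤ ((d + 1 : ℕ) : ℝ) * Real.log ((d + 1) / d) := by
        have h := Real.one_sub_inv_le_log_of_pos (x := ((d : ℝ) + 1) / d) (by positivity)
        have e : 1 - (((d : ℝ) + 1) / d)⁻¹ = 1 / (d + 1) := by field_simp; ring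
        rw [e, div_le_iff₀ (by positivity)] at h
        push_cast
        linarith
      have h2 : Real.exp 1 ≤ (((d : ℝ) + 1) / d) ^ (d + 1) := by
        have := Real.exp_le_exp.2 hlog
        rwa [Real.exp_nat_mul, Real.exp_log (by positivity)] at this
      rw [div_pow, le_div_iff₀ (by positivity)] at h2
      rw [← pow_succ']
      exact h2
    calc ((d + 1).factorial : ℝ) * Real.exp ((d + 1 : ℕ) : ℝ)
        = ((d : ℝ) + 1) * Real.exp 1 * ((d.factorial : ℝ) * Real.exp d) := by
          rw [Nat.factorial_succ]; push_cast; rw [Real.exp_add]; ring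
      _ ≤ ((d : ℝ) + 1) * Real.exp 1 * (Real.exp 1 * d * (d : ℝ) ^ d) := by gcongr
      _ = ((d : ℝ) + 1) * Real.exp 1 * (Real.exp 1 * (d * (d : ℝ) ^ d)) := by ring
      _ ≤ ((d : ℝ) + 1) * Real.exp 1 * ((d : ℝ) + 1) ^ (d + 1) := by gcongr
      _ = Real.exp 1 * ((d + 1 : ℕ) : ℝ) * ((d + 1 : ℕ) : ℝ) ^ (d + 1) := by push_cast; ring

lemma integral_prod_fst {f : ℝ → ℝ} : ∫ p, f p.1 ∂(π.prod π) = ∫ x, f x ∂π := by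
  have := integral_prod_mul (μ := π) (ν := π) f (fun _ => (1 : ℝ))
  simpa using this

lemma integral_prod_snd {f : ℝ → ℝ} : ∫ p, f p.2 ∂(π.prod π) = ∫ x, f x ∂π := by
  have := integral_prod_mul (μ := π) (ν := π) (fun _ => (1 : ℝ)) f
  simpa using this

lemma IsSpikePrior.integral_mul (hπ : IsSpikePrior π) :
    ∫ p : ℝ × ℝ, p.1 * p.2 ∂(π.prod π) = 0 := by
  rw [integral_prod_mul (fun x => x) (fun x => x), hπ.centered, zero_mul]

lemma IsSpikePrior.integral_mul_sq (hπ : IsSpikePrior π) :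
    ∫ p : ℝ × ℝ, (p.1 * p.2) ^ 2 ∂(π.prod π) = 1 := by
  simp_rw [mul_pow]
  rw [integral_prod_mul (fun x => x ^ 2) (fun x => x ^ 2), hπ.unit_variance, one_mul]

/-- Moment bounds for the inner product of two independent vectors with i.i.d. entries. -/
lemma IsSpikePrior.exists_integral_pairSum_mul_pow_le (hπ : IsSpikePrior π) {η : ℝ} (hη : 0 < η) :
    ∃ δ : ℝ, 0 < δ ∧ ∀ (n d : ℕ), 1 ≤ d → (2 * d : ℝ) ≤ δ * n →
      Integrable (fun ω => pairSum (fun p => p.1 * p.2) n ω ^ (2 * d)) (pairSeq π) ∧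
      ∫ ω, pairSum (fun p => p.1 * p.2) n ω ^ (2 * d) ∂(pairSeq π)
        ≤ 2 * (2 * d).factorial * Real.exp d * ((1 + η) * n / (2 * d)) ^ d := by
  obtain ⟨δ₁, hδ₁, h₁⟩ := exists_mgf_le_exp_sq (hπ.mem_interior_mul 1 (by simp))
    (by simpa using hπ.integral_mul) (by simpa using hπ.integral_mul_sq) hη
  obtain ⟨δ₂, hδ₂, h₂⟩ := exists_mgf_le_exp_sq (hπ.mem_interior_mul (-1) (by simp))
    (by simpa [integral_neg] using hπ.integral_mul) (by simpa using hπ.integral_mul_sq) hη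
  set δ := min δ₁ δ₂ with hδ
  have hδ0 : 0 < δ := lt_min hδ₁ hδ₂
  refine ⟨δ ^ 2, by positivity, fun n d hd hdn => ?_⟩
  have hd0 : (0 : ℝ) < d := by exact_mod_cast hd
  have hn0 : (0 : ℝ) < n := by
    by_contra hcon
    have : (n : ℝ) = 0 := le_antisymm (not_lt.1 hcon) (Nat.cast_nonneg n)
    rw [this] at hdn
    linarith
  -- This `s` minimises `exp((1 + η) n s² / 2) / s^(2d)`, the bound on the moment of order `2d`; the
  -- exponential factor becomes `exp d`. The hypothesis `2d ≤ δ² n` keeps `s` in the range where the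
  -- generating function bound holds.
  set s : ℝ := √(2 * d / ((1 + η) * n)) with hs
  have hs0 : 0 < s := by positivity
  have hs2 : s ^ 2 = 2 * d / ((1 + η) * n) := Real.sq_sqrt (by positivity)
  have hsδ : s ≤ δ := by
    refine abs_le_of_sq_le_sq' ?_ hδ0.le |>.2
    rw [hs2, div_le_iff₀ (by positivity)]
    nlinarith [mul_pos (mul_pos hδ0 hδ0) hn0]
  obtain ⟨hi₁, hm₁⟩ := h₁ s ⟨hs0.le, hsδ.trans (min_le_left _ _)⟩
  obtain ⟨hi₂, hm₂⟩ := h₂ s ⟨hs0.le, hsδ.trans (min_le_right _ _)⟩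
  have hneg : ∀ ω, pairSum (fun p => -1 * (p.1 * p.2)) n ω
      = -pairSum (fun p => p.1 * p.2) n ω := by
    intro ω; simp [pairSum]
  have hone : (fun p : ℝ × ℝ => 1 * (p.1 * p.2)) = fun p => p.1 * p.2 := by ext; ring
  rw [hone] at hm₁
  simp only [one_mul] at hi₁
  have hI₁ := integrable_exp_mul_pairSum π (by fun_prop) n hi₁
  have hI₂ := integrable_exp_mul_pairSum π (by fun_prop) n hi₂
  simp_rw [hneg] at hI₂
  have hE : ∀ {f : ℝ × ℝ → ℝ}, Measurable f →
      mgf f (π.prod π) s ≤ Real.exp ((1 + η) * s ^ 2 / 2) →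
      ∫ ω, Real.exp (s * pairSum f n ω) ∂(pairSeq π) ≤ Real.exp d := by
    intro f hf hle
    have h := mgf_pairSum π hf n s
    rw [mgf] at h
    rw [h]
    refine (pow_le_pow_left₀ mgf_nonneg hle n).trans ?_
    rw [← Real.exp_nat_mul]
    refine Real.exp_le_exp.2 (le_of_eq ?_)
    rw [hs2]
    field_simp
  have hE₁ := hE (by fun_prop) hm₁
  have hE₂ := hE (by fun_prop) hm₂
  simp_rw [hneg] at hE₂
  have hmeas : Measurable fun ω => pairSum (fun p => p.1 * p.2) n ω ^ (2 * d) :=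
    (measurable_pairSum (by fun_prop) n).pow_const _
  have hdom := (hI₁.add hI₂).const_mul ((2 * d).factorial / s ^ (2 * d) : ℝ)
  have hle : ∀ ω, pairSum (fun p => p.1 * p.2) n ω ^ (2 * d)
      ≤ (2 * d).factorial / s ^ (2 * d) * (Real.exp (s * pairSum (fun p => p.1 * p.2) n ω)
        + Real.exp (s * -pairSum (fun p => p.1 * p.2) n ω)) :=
    fun ω => pow_two_mul_le_exp hs0 _ d
  have hint : Integrable (fun ω => pairSum (fun p => p.1 * p.2) n ω ^ (2 * d)) (pairSeq π) := by
    refine hdom.mono' hmeas.aestronglyMeasurable (ae_of_all _ fun ω => ?_)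
    rw [Real.norm_of_nonneg (Even.pow_nonneg (even_two_mul d) _)]
    exact hle ω
  refine ⟨hint, (integral_mono hint hdom hle).trans ?_⟩
  simp only [Pi.add_apply]
  rw [integral_const_mul, integral_add hI₁ hI₂]
  calc ((2 * d).factorial / s ^ (2 * d) : ℝ) *
        (∫ ω, Real.exp (s * pairSum (fun p => p.1 * p.2) n ω) ∂(pairSeq π)
          + ∫ ω, Real.exp (s * -pairSum (fun p => p.1 * p.2) n ω) ∂(pairSeq π))
      ≤ ((2 * d).factorial / s ^ (2 * d) : ℝ) * (Real.exp d + Real.exp d) := by gcongr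
    _ = 2 * (2 * d).factorial * Real.exp d * ((1 + η) * n / (2 * d)) ^ d := by
      rw [pow_mul, hs2, ← one_div_div (2 * d : ℝ) ((1 + η) * n), div_pow 1, one_pow]
      ring

/-- The squared norm of a vector with i.i.d. entries is rarely small. -/
lemma IsSpikePrior.exists_measure_normSq_le (hπ : IsSpikePrior π) {η : ℝ} (hη : 0 < η) :
    ∃ κ : ℝ, 0 < κ ∧ ∀ n : ℕ,
      (pairSeq π).real {ω | pairSum (fun p => p.1 ^ 2) n ω ≤ (1 - η) * n} ≤ Real.exp (-κ * n) ∧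
      (pairSeq π).real {ω | pairSum (fun p => p.2 ^ 2) n ω ≤ (1 - η) * n} ≤ Real.exp (-κ * n) := by
  have h0 : ∫ x, (1 - x ^ 2) ∂π = 0 := by
    rw [integral_sub (integrable_const _) (hπ.integrable_pow 2), hπ.unit_variance]
    simp
  -- The deviation has size `η n`; a generating function growing at rate only `η / 2` leaves the
  -- Chernoff exponent `-(η / 2) t n`.
  obtain ⟨t, ht, hint, hmgf⟩ := exists_mgf_le_exp_mul hπ.mem_interior_one_sub_sq h0 (half_pos hη)
  have key : ∀ (q : ℝ × ℝ → ℝ), Measurable q →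
      Integrable (fun p => Real.exp (t * (1 - q p ^ 2))) (π.prod π) →
      mgf (fun p => 1 - q p ^ 2) (π.prod π) t ≤ Real.exp (η / 2 * t) → ∀ n : ℕ,
      (pairSeq π).real {ω | pairSum (fun p => q p ^ 2) n ω ≤ (1 - η) * n}
        ≤ Real.exp (-(η / 2 * t) * n) := by
    intro q hq hi hm n
    have hset : {ω | pairSum (fun p => q p ^ 2) n ω ≤ (1 - η) * n}
        = {ω | η * n ≤ pairSum (fun p => 1 - q p ^ 2) n ω} := by
      ext ω
      have : pairSum (fun p => 1 - q p ^ 2) n ω = n - pairSum (fun p => q p ^ 2) n ω := by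
        simp [pairSum]
      simp only [Set.mem_ofPred_eq, this]
      constructor <;> intro h <;> linarith
    rw [hset]
    refine (measure_ge_le_exp_mul_mgf _ ht.le
      (integrable_exp_mul_pairSum π (by fun_prop) n hi)).trans ?_
    rw [mgf_pairSum π (by fun_prop)]
    calc Real.exp (-t * (η * n)) * mgf (fun p => 1 - q p ^ 2) (π.prod π) t ^ n
        ≤ Real.exp (-t * (η * n)) * Real.exp (η / 2 * t) ^ n := by
          gcongr; exact mgf_nonneg
      _ = Real.exp (-(η / 2 * t) * n) := by
          rw [← Real.exp_nat_mul, ← Real.exp_add]; congr 1; ring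
  refine ⟨η / 2 * t, by positivity, fun n => ⟨key Prod.fst measurable_fst ?_ ?_ n,
    key Prod.snd measurable_snd ?_ ?_ n⟩⟩
  · exact hint.comp_fst π
  · rw [mgf, integral_prod_fst (f := fun x => Real.exp (t * (1 - x ^ 2)))]
    exact hmgf
  · exact hint.comp_snd π
  · rw [mgf, integral_prod_snd (f := fun x => Real.exp (t * (1 - x ^ 2)))]
    exact hmgf

end PairSequence

/-! ### A summable bound on the degree contributions, uniform in the dimension -/

section MomentBound

variable {π : Measure ℝ} [IsProbabilityMeasure π]

/-- The degree-`d` contribution to the squared norm of the likelihood ratio. -/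
noncomputable def degreeWeight (lam : ℝ) (π : Measure ℝ) [IsProbabilityMeasure π] (n d : ℕ) : ℝ :=
  (lam ^ 2 / 2) ^ d / d.factorial * ∫ ω, (n * seqOverlap n ω) ^ d ∂(pairSeq π)

lemma degreeWeight_nonneg (lam : ℝ) (n d : ℕ) : 0 ≤ degreeWeight lam π n d :=
  mul_nonneg (by positivity) (integral_nonneg fun ω =>
    pow_nonneg (mul_nonneg (Nat.cast_nonneg n) (seqOverlap_nonneg n ω)) d)

lemma integrable_seqOverlap_pow (n d : ℕ) :
    Integrable (fun ω => ((n : ℝ) * seqOverlap n ω) ^ d) (pairSeq π) := by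
  refine Integrable.of_bound (C := (n : ℝ) ^ d)
    (((measurable_seqOverlap n).const_mul _).pow_const _).aestronglyMeasurable
    (ae_of_all _ fun ω => ?_)
  have h0 : 0 ≤ (n : ℝ) * seqOverlap n ω :=
    mul_nonneg (Nat.cast_nonneg n) (seqOverlap_nonneg n ω)
  rw [Real.norm_of_nonneg (pow_nonneg h0 d)]
  exact pow_le_pow_left₀ h0
    (mul_le_of_le_one_right (Nat.cast_nonneg n) (seqOverlap_le_one n ω)) d

/-- When both squared norms exceed `(1 - η) n` the denominator of the overlap can be replaced by its
lower bound. Otherwise the overlap is at most `1` by Cauchy–Schwarz, and an indicator pays `n ^ d`.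
-/
lemma seqOverlap_pow_le {η : ℝ} (hη : η < 1) {n : ℕ} (hn : 0 < n) (d : ℕ) (ω : ℕ → ℝ × ℝ) :
    ((n : ℝ) * seqOverlap n ω) ^ d
      ≤ pairSum (fun p => p.1 * p.2) n ω ^ (2 * d) / (n * (1 - η) ^ 2) ^ d
        + n ^ d * ({ω | pairSum (fun p => p.1 ^ 2) n ω ≤ (1 - η) * n}.indicator 1 ω
          + {ω | pairSum (fun p => p.2 ^ 2) n ω ≤ (1 - η) * n}.indicator 1 ω) := by
  have hn0 : (0 : ℝ) < n := by exact_mod_cast hn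
  have h1η : 0 < 1 - η := by linarith
  have hR0 : 0 ≤ (n : ℝ) * seqOverlap n ω :=
    mul_nonneg (Nat.cast_nonneg n) (seqOverlap_nonneg n ω)
  have hRn : ((n : ℝ) * seqOverlap n ω) ^ d ≤ n ^ d := pow_le_pow_left₀ hR0
    (mul_le_of_le_one_right (Nat.cast_nonneg n) (seqOverlap_le_one n ω)) d
  have hS : 0 ≤ pairSum (fun p => p.1 * p.2) n ω ^ (2 * d) / (n * (1 - η) ^ 2) ^ d :=
    div_nonneg (Even.pow_nonneg (even_two_mul d) _) (by positivity)
  have hi₁ : 0 ≤ {ω | pairSum (fun p => p.1 ^ 2) n ω ≤ (1 - η) * n}.indicator (1 : (ℕ → ℝ × ℝ) → ℝ) ω :=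
    Set.indicator_nonneg (fun _ _ => zero_le_one) _
  have hi₂ : 0 ≤ {ω | pairSum (fun p => p.2 ^ 2) n ω ≤ (1 - η) * n}.indicator (1 : (ℕ → ℝ × ℝ) → ℝ) ω :=
    Set.indicator_nonneg (fun _ _ => zero_le_one) _
  have hnd : (0 : ℝ) < n ^ d := by positivity
  by_cases hA : ω ∈ {ω | pairSum (fun p => p.1 ^ 2) n ω ≤ (1 - η) * n}
  · have h1 := Set.indicator_of_mem hA (1 : (ℕ → ℝ × ℝ) → ℝ)
    rw [Pi.one_apply] at h1
    rw [h1]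
    nlinarith
  by_cases hB : ω ∈ {ω | pairSum (fun p => p.2 ^ 2) n ω ≤ (1 - η) * n}
  · have h1 := Set.indicator_of_mem hB (1 : (ℕ → ℝ × ℝ) → ℝ)
    rw [Pi.one_apply] at h1
    rw [h1]
    nlinarith
  have hA' : (1 - η) * n < pairSum (fun p => p.1 ^ 2) n ω := not_le.1 hA
  have hB' : (1 - η) * n < pairSum (fun p => p.2 ^ 2) n ω := not_le.1 hB
  have hmain : (n : ℝ) * seqOverlap n ω
      ≤ pairSum (fun p => p.1 * p.2) n ω ^ 2 / (n * (1 - η) ^ 2) := by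
    have hAB : ((1 - η) * n) * ((1 - η) * n)
        ≤ pairSum (fun p => p.1 ^ 2) n ω * pairSum (fun p => p.2 ^ 2) n ω :=
      mul_le_mul hA'.le hB'.le (by positivity) (le_trans (by positivity) hA'.le)
    have h2 : seqOverlap n ω ≤ pairSum (fun p => p.1 * p.2) n ω ^ 2
        / (((1 - η) * n) * ((1 - η) * n)) :=
      div_le_div_of_nonneg_left (sq_nonneg _) (by positivity) hAB
    calc (n : ℝ) * seqOverlap n ω
        ≤ n * (pairSum (fun p => p.1 * p.2) n ω ^ 2 / (((1 - η) * n) * ((1 - η) * n))) := by gcongr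
      _ = pairSum (fun p => p.1 * p.2) n ω ^ 2 / (n * (1 - η) ^ 2) := by
          field_simp
  calc ((n : ℝ) * seqOverlap n ω) ^ d
      ≤ (pairSum (fun p => p.1 * p.2) n ω ^ 2 / (n * (1 - η) ^ 2)) ^ d :=
        pow_le_pow_left₀ hR0 hmain d
    _ = pairSum (fun p => p.1 * p.2) n ω ^ (2 * d) / (n * (1 - η) ^ 2) ^ d := by
        rw [div_pow, pow_mul]
    _ ≤ _ := le_add_of_nonneg_right (by positivity)

/-- The strict inequality `lam < 1` leaves room for the losses `1 + η` (moments) and `(1 - η)⁻²`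
(norms). -/
lemma exists_inflation_lt_one {lam : ℝ} (hlam : lam ∈ Set.Ioo (0 : ℝ) 1) :
    ∃ η : ℝ, 0 < η ∧ η < 1 ∧ lam ^ 2 * (1 + η) / (1 - η) ^ 2 < 1 := by
  have hc : ContinuousAt (fun η : ℝ => lam ^ 2 * (1 + η) / (1 - η) ^ 2) 0 := by
    refine ContinuousAt.div (by fun_prop) (by fun_prop) (by norm_num)
  have hlt : ∀ᶠ η in 𝓝 (0 : ℝ), lam ^ 2 * (1 + η) / (1 - η) ^ 2 < 1 := by
    refine hc.eventually_lt continuousAt_const ?_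
    have := hlam.1
    have := hlam.2
    norm_num
    rw [abs_of_pos hlam.1]
    exact hlam.2
  obtain ⟨η, h1, h2, h3⟩ := ((hlt.filter_mono nhdsWithin_le_nhds).and
    (Ioo_mem_nhdsGT (zero_lt_one (α := ℝ)))).exists
  exact ⟨η, h2, h3, h1⟩

/-- A summable bound on the degree contributions, uniform in the dimension, in the range
`d log n ≤ κ n`. -/
lemma IsSpikePrior.exists_summable_bound (hπ : IsSpikePrior π) {lam : ℝ}
    (hlam : lam ∈ Set.Ioo (0 : ℝ) 1) :
    ∃ b : ℕ → ℝ, Summable b ∧ (∀ d, 0 ≤ b d) ∧ ∃ κ : ℝ, 0 < κ ∧ ∀ n : ℕ, 3 ≤ n → ∀ d : ℕ,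
      d * Real.log n ≤ κ * n → degreeWeight lam π n d ≤ b d := by
  obtain ⟨η, hη0, hη1, hρ⟩ := exists_inflation_lt_one hlam
  set ρ := lam ^ 2 * (1 + η) / (1 - η) ^ 2 with hρdef
  have h1η : 0 < 1 - η := by linarith
  have hρ0 : 0 ≤ ρ := by positivity
  obtain ⟨δ, hδ, hmom⟩ := hπ.exists_integral_pairSum_mul_pow_le hη0
  obtain ⟨c, hc, htail⟩ := hπ.exists_measure_normSq_le hη0
  refine ⟨fun d => 2 * Real.exp 1 * ((d : ℝ) ^ 1 * ρ ^ d) + 2 * (1 / 2) ^ d, ?_, ?_,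
    min (δ / 2) c, lt_min (half_pos hδ) hc, ?_⟩
  · have h1 : Summable fun d : ℕ => (d : ℝ) ^ 1 * ρ ^ d :=
      summable_pow_mul_geometric_of_norm_lt_one 1 (by rwa [Real.norm_of_nonneg hρ0])
    exact (h1.mul_left (2 * Real.exp 1)).add (summable_geometric_two.mul_left 2)
  · intro d; positivity
  intro n hn d hd
  rcases Nat.eq_zero_or_pos d with rfl | hdpos
  · simp [degreeWeight]
  have hn3 : (3 : ℝ) ≤ n := by exact_mod_cast hn
  have hn0 : (0 : ℝ) < n := by linarith
  have hd0 : (0 : ℝ) < d := by exact_mod_cast hdpos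
  -- From `n ≥ 3 > e`. It turns `d log n ≤ κ n` into `d ≤ κ n`, which the moment bound requires.
  have hlog : 1 ≤ Real.log n := by
    rw [Real.le_log_iff_exp_le hn0]
    linarith [Real.exp_one_lt_d9]
  have hdδ : (2 * d : ℝ) ≤ δ * n := by
    have h1 : min (δ / 2) c * n ≤ δ / 2 * n := by gcongr; exact min_le_left _ _
    nlinarith
  have hdc : d * Real.log n ≤ c * n :=
    hd.trans (by gcongr; exact min_le_right _ _)
  obtain ⟨hSint, hSle⟩ := hmom n d hdpos hdδ
  obtain ⟨hA, hB⟩ := htail n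
  set A : Set (ℕ → ℝ × ℝ) := {ω | pairSum (fun p => p.1 ^ 2) n ω ≤ (1 - η) * n} with hAdef
  set B : Set (ℕ → ℝ × ℝ) := {ω | pairSum (fun p => p.2 ^ 2) n ω ≤ (1 - η) * n} with hBdef
  have hAm : MeasurableSet A := measurableSet_le (measurable_pairSum (by fun_prop) n) (by fun_prop)
  have hBm : MeasurableSet B := measurableSet_le (measurable_pairSum (by fun_prop) n) (by fun_prop)
  have hAi : Integrable (A.indicator (1 : (ℕ → ℝ × ℝ) → ℝ)) (pairSeq π) :=
    (integrable_const (1 : ℝ)).indicator hAm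
  have hBi : Integrable (B.indicator (1 : (ℕ → ℝ × ℝ) → ℝ)) (pairSeq π) :=
    (integrable_const (1 : ℝ)).indicator hBm
  have hmoment : ∫ ω, ((n : ℝ) * seqOverlap n ω) ^ d ∂(pairSeq π)
      ≤ (2 * (2 * d).factorial * Real.exp d * ((1 + η) * n / (2 * d)) ^ d) / (n * (1 - η) ^ 2) ^ d
        + n ^ d * (Real.exp (-c * n) + Real.exp (-c * n)) := by
    refine (integral_mono (integrable_seqOverlap_pow n d)
      ((hSint.div_const _).add ((hAi.add hBi).const_mul _))
      (seqOverlap_pow_le hη1 (by omega) d)).trans ?_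
    simp only [Pi.add_apply]
    have hAB : Integrable (fun ω => (n : ℝ) ^ d * (A.indicator 1 ω + B.indicator 1 ω))
        (pairSeq π) := (hAi.add hBi).const_mul _
    rw [integral_add (hSint.div_const _) hAB, integral_div,
      integral_const_mul, integral_add hAi hBi, integral_indicator_one hAm,
      integral_indicator_one hBm]
    gcongr
  have hweight : (0 : ℝ) ≤ (lam ^ 2 / 2) ^ d / d.factorial := by positivity
  -- The constants cancel: `(2d)! / d! ≤ 4^d d!` meets `4^d d^d` in the denominator, and `d! e^d /
  -- d^d ≤ e d`. What remains is `d ρ^d` up to a constant.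
  have hfirst : (lam ^ 2 / 2) ^ d / d.factorial *
      ((2 * (2 * d).factorial * Real.exp d * ((1 + η) * n / (2 * d)) ^ d) / (n * (1 - η) ^ 2) ^ d)
        ≤ 2 * Real.exp 1 * ((d : ℝ) ^ 1 * ρ ^ d) := by
    have hfac : (0 : ℝ) < d.factorial := by positivity
    have hpow : (lam ^ 2 / 2) ^ d * ((1 + η) * n / (2 * d)) ^ d / (n * (1 - η) ^ 2) ^ d
        = ρ ^ d / (4 ^ d * (d : ℝ) ^ d) := by
      rw [← mul_pow, ← div_pow, ← mul_pow, ← div_pow, hρdef]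
      congr 1
      field_simp
      norm_num
    calc (lam ^ 2 / 2) ^ d / d.factorial *
        ((2 * (2 * d).factorial * Real.exp d * ((1 + η) * n / (2 * d)) ^ d)
          / (n * (1 - η) ^ 2) ^ d)
        = 2 * ((2 * d).factorial * Real.exp d / d.factorial)
          * ((lam ^ 2 / 2) ^ d * ((1 + η) * n / (2 * d)) ^ d / (n * (1 - η) ^ 2) ^ d) := by ring
      _ = 2 * ((2 * d).factorial * Real.exp d / d.factorial) * (ρ ^ d / (4 ^ d * (d : ℝ) ^ d)) := by
          rw [hpow]
      _ ≤ 2 * ((4 ^ d * d.factorial * d.factorial) * Real.exp d / d.factorial)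
          * (ρ ^ d / (4 ^ d * (d : ℝ) ^ d)) := by
          gcongr
          exact factorial_two_mul_le d
      _ = 2 * (d.factorial * Real.exp d) * (ρ ^ d / (d : ℝ) ^ d) := by
          field_simp
      _ ≤ 2 * (Real.exp 1 * d * (d : ℝ) ^ d) * (ρ ^ d / (d : ℝ) ^ d) := by
          exact mul_le_mul_of_nonneg_right (mul_le_mul_of_nonneg_left
            (factorial_mul_exp_le d hdpos) zero_le_two) (by positivity)
      _ = 2 * Real.exp 1 * ((d : ℝ) ^ 1 * ρ ^ d) := by
          field_simp
  have hsecond : (lam ^ 2 / 2) ^ d / d.factorial *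
      (n ^ d * (Real.exp (-c * n) + Real.exp (-c * n))) ≤ 2 * (1 / 2) ^ d := by
    have h1 : (lam ^ 2 / 2) ^ d / d.factorial ≤ (1 / 2) ^ d := by
      have hfac : (1 : ℝ) ≤ d.factorial := by exact_mod_cast Nat.one_le_iff_ne_zero.2 (by positivity)
      refine (div_le_self (by positivity) hfac).trans (pow_le_pow_left₀ (by positivity) ?_ d)
      nlinarith [hlam.1, hlam.2]
    -- The exponential tail of the norms beats the trivial bound `n ^ d` precisely when `d log n ≤ c
    -- n`.
    have h2 : (n : ℝ) ^ d * Real.exp (-c * n) ≤ 1 := by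
      rw [← Real.exp_log hn0, ← Real.exp_nat_mul, ← Real.exp_add, Real.exp_log hn0,
        Real.exp_le_one_iff]
      linarith
    calc (lam ^ 2 / 2) ^ d / d.factorial * (n ^ d * (Real.exp (-c * n) + Real.exp (-c * n)))
        = (lam ^ 2 / 2) ^ d / d.factorial * (2 * (n ^ d * Real.exp (-c * n))) := by ring
      _ ≤ (1 / 2) ^ d * (2 * 1) := by gcongr
      _ = 2 * (1 / 2) ^ d := by ring
  calc degreeWeight lam π n d
      ≤ (lam ^ 2 / 2) ^ d / d.factorial *
        ((2 * (2 * d).factorial * Real.exp d * ((1 + η) * n / (2 * d)) ^ d)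
          / (n * (1 - η) ^ 2) ^ d + n ^ d * (Real.exp (-c * n) + Real.exp (-c * n))) :=
        mul_le_mul_of_nonneg_left hmoment hweight
    _ ≤ _ := by rw [mul_add]; exact add_le_add hfirst hsecond

end MomentBound

/-! ### Weak limit of the overlap and convergence of its moments -/

section WeakLimit

/-- The difference vanishes for `x ≤ K`; beyond `K` it is at most `x ^ d ≤ x ^ (d + 1) / K`. The
outer `max 0` makes the truncated power bounded on all of `ℝ`, as a test function for weak
convergence must be. -/
lemma abs_pow_sub_min_pow_le {x K : ℝ} (hx : 0 ≤ x) (hK : 0 < K) (d : ℕ) :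
    |x ^ d - (max 0 (min x K)) ^ d| ≤ x ^ (d + 1) / K := by
  rcases le_total x K with h | h
  · rw [min_eq_left h, max_eq_right hx, sub_self, abs_zero]
    positivity
  · rw [min_eq_right h, max_eq_right hK.le,
      abs_of_nonneg (sub_nonneg.2 (pow_le_pow_left₀ hK.le h d)), le_div_iff₀ hK, pow_succ]
    have h1 : 0 ≤ K ^ d := by positivity
    have h2 : 0 ≤ x ^ d := by positivity
    nlinarith

lemma abs_integral_pow_sub_truncated_le {Ω : Type*} {m : MeasurableSpace Ω} {P : Measure Ω}
    [IsProbabilityMeasure P] {Y : Ω → ℝ} (hY : ∀ ω, 0 ≤ Y ω) (hYm : AEMeasurable Y P)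
    (hYi : ∀ k, Integrable (fun ω => Y ω ^ k) P) (d : ℕ) {K : ℝ} (hK : 0 < K) :
    |∫ ω, Y ω ^ d ∂P - ∫ ω, (max 0 (min (Y ω) K)) ^ d ∂P| ≤ (∫ ω, Y ω ^ (d + 1) ∂P) / K := by
  have hti : Integrable (fun ω => (max 0 (min (Y ω) K)) ^ d) P := by
    refine Integrable.of_bound (C := K ^ d) (by fun_prop) (ae_of_all _ fun ω => ?_)
    rw [Real.norm_of_nonneg (by positivity)]
    exact pow_le_pow_left₀ (le_max_left _ _) (max_le hK.le (min_le_right _ _)) d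
  rw [← integral_sub (hYi d) hti, ← integral_div]
  refine (abs_integral_le_integral_abs).trans ?_
  exact integral_mono ((hYi d).sub hti).abs ((hYi (d + 1)).div_const K)
    fun ω => abs_pow_sub_min_pow_le (hY ω) hK d

/-- Convergence in distribution of nonnegative variables together with a bound on the moments of
order `d + 1` gives convergence of the moments of order `d`. -/
lemma tendsto_integral_pow_of_tendstoInDistribution {Ω Ω' : Type*} {m : MeasurableSpace Ω}
    {m' : MeasurableSpace Ω'} {P : Measure Ω} {P' : Measure Ω'} [IsProbabilityMeasure P]
    [IsProbabilityMeasure P'] {X : ℕ → Ω → ℝ} {Z : Ω' → ℝ}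
    (h : TendstoInDistribution X atTop Z (fun _ => P) P') (hX : ∀ n ω, 0 ≤ X n ω)
    (hZ : ∀ ω, 0 ≤ Z ω) (hXint : ∀ n k, Integrable (fun ω => X n ω ^ k) P)
    (hZint : ∀ k, Integrable (fun ω => Z ω ^ k) P') (d : ℕ) {C : ℝ}
    (hC : ∀ᶠ n in atTop, ∫ ω, X n ω ^ (d + 1) ∂P ≤ C) :
    Tendsto (fun n => ∫ ω, X n ω ^ d ∂P) atTop (𝓝 (∫ ω, Z ω ^ d ∂P')) := by
  have htrunc : ∀ K : ℝ, 0 < K → Tendsto (fun n => ∫ ω, (max 0 (min (X n ω) K)) ^ d ∂P) atTop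
      (𝓝 (∫ ω, (max 0 (min (Z ω) K)) ^ d ∂P')) := by
    intro K hK
    have hc : Continuous fun x : ℝ => (max 0 (min x K)) ^ d := by fun_prop
    have hb : ∀ x : ℝ, ‖(max 0 (min x K)) ^ d‖ ≤ K ^ d := by
      intro x
      rw [Real.norm_of_nonneg (by positivity)]
      exact pow_le_pow_left₀ (le_max_left _ _) (max_le hK.le (min_le_right _ _)) d
    have := ProbabilityMeasure.tendsto_iff_forall_integral_tendsto.1 h.tendsto
      (BoundedContinuousFunction.ofNormedAddCommGroup _ hc _ hb)
    simp only [BoundedContinuousFunction.coe_ofNormedAddCommGroup, ProbabilityMeasure.coe_mk]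
      at this
    rw [integral_map h.aemeasurable_limit hc.aestronglyMeasurable] at this
    refine this.congr fun n => ?_
    rw [integral_map (h.forall_aemeasurable n) hc.aestronglyMeasurable]
  rw [Metric.tendsto_nhds]
  intro ε hε
  set C' := ∫ ω, Z ω ^ (d + 1) ∂P' with hC'
  have hC'0 : 0 ≤ C' := integral_nonneg fun ω => pow_nonneg (hZ ω) _
  obtain ⟨K, hK0, hK⟩ : ∃ K : ℝ, 0 < K ∧ (|C| + C') / K < ε / 2 := by
    refine ⟨2 * (|C| + C' + 1) / ε, by positivity, ?_⟩
    rw [div_lt_iff₀ (by positivity)]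
    have : ε / 2 * (2 * (|C| + C' + 1) / ε) = |C| + C' + 1 := by field_simp
    rw [this]
    linarith
  filter_upwards [hC, (Metric.tendsto_nhds.1 (htrunc K hK0)) (ε / 2) (half_pos hε)] with n h1 h2
  have h3 := abs_integral_pow_sub_truncated_le (hX n) (h.forall_aemeasurable n) (hXint n) d hK0
  have h4 := abs_integral_pow_sub_truncated_le hZ h.aemeasurable_limit hZint d hK0
  rw [Real.dist_eq] at h2 ⊢
  have h5 : (∫ ω, X n ω ^ (d + 1) ∂P) / K ≤ |C| / K :=
    div_le_div_of_nonneg_right (h1.trans (le_abs_self C)) hK0.le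
  rw [add_div] at hK
  rw [abs_lt] at h2 ⊢
  rw [abs_le] at h3 h4
  constructor <;> linarith

variable {π : Measure ℝ} [IsProbabilityMeasure π]

lemma ae_tendsto_pairSum_div {f : ℝ × ℝ → ℝ} (hf : Measurable f)
    (hint : Integrable f (π.prod π)) (h1 : ∫ p, f p ∂(π.prod π) = 1) :
    ∀ᵐ ω ∂(pairSeq π), Tendsto (fun n : ℕ => pairSum f n ω / n) atTop (𝓝 1) := by
  have h := strong_law_ae_real (μ := pairSeq π) (fun i (ω : ℕ → ℝ × ℝ) => f (ω i))
    (integrable_comp_pairSeq π hint 0)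
    (fun i j hij => (iIndepFun_pairSeq π hf).indepFun hij)
    (fun i => identDistrib_pairSeq π hf i 0)
  rwa [integral_comp_pairSeq π hf, h1] at h

/-- Slutsky: the normalised inner product is asymptotically standard normal by the central limit
theorem, while the normalised squared norms tend to `1` by the strong law. -/
lemma IsSpikePrior.tendstoInDistribution_seqOverlap (hπ : IsSpikePrior π) :
    TendstoInDistribution (fun (n : ℕ) ω => (n : ℝ) * seqOverlap n ω) atTop
      (fun x : ℝ => x ^ 2) (fun _ => pairSeq π) (gaussianReal 0 1) := by
  have hclt := tendstoInDistribution_inv_sqrt_mul_sum (P := pairSeq π) (P' := gaussianReal 0 1)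
    (Y := id) (X := fun i ω => (ω i).1 * (ω i).2) HasLaw.id
    (by rw [integral_comp_pairSeq π (f := fun p => p.1 * p.2) (by fun_prop), hπ.integral_mul])
    (by
      have := integral_comp_pairSeq π (f := fun p => (p.1 * p.2) ^ 2) (by fun_prop) 0
      rw [hπ.integral_mul_sq] at this
      exact this)
    (iIndepFun_pairSeq π (f := fun p => p.1 * p.2) (by fun_prop))
    (fun i => identDistrib_pairSeq π (f := fun p => p.1 * p.2) (by fun_prop) i 0)
  set V : ℕ → (ℕ → ℝ × ℝ) → ℝ := fun n ω =>
    (pairSum (fun p => p.1 ^ 2) n ω / n * (pairSum (fun p => p.2 ^ 2) n ω / n))⁻¹ with hV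
  have hVm : ∀ n, Measurable (V n) := fun n =>
    (((measurable_pairSum (by fun_prop) n).div_const _).mul
      ((measurable_pairSum (by fun_prop) n).div_const _)).inv
  have hVlim : TendstoInMeasure (pairSeq π) V atTop (fun _ => (1 : ℝ)) := by
    refine tendstoInMeasure_of_tendsto_ae (fun n => (hVm n).aestronglyMeasurable) ?_
    filter_upwards [ae_tendsto_pairSum_div (π := π) (f := fun p => p.1 ^ 2) (by fun_prop)
        ((hπ.integrable_pow 2).comp_fst π)
        ((integral_prod_fst (f := fun x => x ^ 2)).trans hπ.unit_variance),
      ae_tendsto_pairSum_div (π := π) (f := fun p => p.2 ^ 2) (by fun_prop)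
        ((hπ.integrable_pow 2).comp_snd π)
        ((integral_prod_snd (f := fun x => x ^ 2)).trans hπ.unit_variance)] with ω h1 h2
    have h3 := (h1.mul h2).inv₀ (by norm_num)
    rwa [mul_one, inv_one] at h3
  have hg : Continuous fun q : ℝ × ℝ => q.1 ^ 2 * q.2 := by fun_prop
  have h := hclt.continuous_comp_prodMk_of_tendstoInMeasure_const hg hVlim
    (fun n => (hVm n).aemeasurable)
  refine h.congr (fun n => ae_of_all _ fun ω => ?_) (ae_of_all _ fun x => by simp)
  simp only [hV, seqOverlap]
  change ((√(n : ℝ))⁻¹ * pairSum (fun p => p.1 * p.2) n ω) ^ 2 * _ = _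
  rw [mul_pow, inv_pow, Real.sq_sqrt (Nat.cast_nonneg n)]
  rcases Nat.eq_zero_or_pos n with rfl | hn
  · simp
  have hn0 : (n : ℝ) ≠ 0 := by positivity
  rw [div_mul_div_comm, inv_div]
  field_simp

/-- Weak convergence passes to moments once the next moment is bounded. The uniform bound at degree
`d + 1` supplies this, since a fixed degree satisfies `(d + 1) log n ≤ κ n` eventually. -/
lemma IsSpikePrior.tendsto_degreeWeight (hπ : IsSpikePrior π) {lam : ℝ}
    (hlam : lam ∈ Set.Ioo (0 : ℝ) 1) (d : ℕ) :
    Tendsto (fun n => degreeWeight lam π n d) atTop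
      (𝓝 ((lam ^ 2 / 2) ^ d / d.factorial * ∫ x, (x ^ 2) ^ d ∂(gaussianReal 0 1))) := by
  obtain ⟨b, -, -, κ, hκ, hb⟩ := hπ.exists_summable_bound hlam
  have hco : 0 < (lam ^ 2 / 2) ^ (d + 1) / ((d + 1).factorial : ℝ) := by
    have := hlam.1
    positivity
  have hlog : ∀ᶠ n : ℕ in atTop, ((d + 1 : ℕ) : ℝ) * Real.log n ≤ κ * n := by
    have h := (Real.isLittleO_log_id_atTop.comp_tendsto tendsto_natCast_atTop_atTop).def
      (c := κ / (d + 1 : ℕ)) (by positivity)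
    filter_upwards [h] with n hn
    simp only [Function.comp, id, Real.norm_eq_abs, Nat.abs_cast] at hn
    have := (le_abs_self _).trans hn
    rw [div_mul_eq_mul_div, le_div_iff₀ (by positivity)] at this
    linarith
  refine Tendsto.const_mul _ ?_
  refine tendsto_integral_pow_of_tendstoInDistribution hπ.tendstoInDistribution_seqOverlap
    (fun n ω => mul_nonneg (Nat.cast_nonneg n) (seqOverlap_nonneg n ω)) (fun x => sq_nonneg x)
    (fun n k => integrable_seqOverlap_pow n k) (fun k => ?_) d
    (C := b (d + 1) / ((lam ^ 2 / 2) ^ (d + 1) / ((d + 1).factorial : ℝ))) ?_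
  · simp_rw [← pow_mul]
    exact integrable_pow_gaussianReal 0 1 _
  · filter_upwards [hlog, eventually_ge_atTop 3] with n h1 h2
    rw [le_div_iff₀ hco, mul_comm]
    exact hb n h2 (d + 1) h1

/-- The limiting series is the exponential moment of the square of a standard Gaussian. -/
lemma hasSum_gaussian_even_moments {b : ℝ} (hb0 : 0 ≤ b) (hb : b < 1 / 2) :
    HasSum (fun d : ℕ => b ^ d / d.factorial * ∫ x, (x ^ 2) ^ d ∂(gaussianReal 0 1))
      ((1 - 2 * b) ^ (-(1 / 2) : ℝ)) := by
  have hF : ∀ d : ℕ, Integrable (fun x : ℝ => b ^ d / d.factorial * (x ^ 2) ^ d)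
      (gaussianReal 0 1) := by
    intro d
    simp_rw [← pow_mul]
    exact (integrable_pow_gaussianReal 0 1 _).const_mul _
  have hF0 : ∀ (d : ℕ) (x : ℝ), 0 ≤ b ^ d / d.factorial * (x ^ 2) ^ d := fun d x => by positivity
  have hexp : ∀ x : ℝ, HasSum (fun d : ℕ => b ^ d / d.factorial * (x ^ 2) ^ d)
      (Real.exp (b * x ^ 2)) := by
    intro x
    have h := NormedSpace.expSeries_div_hasSum_exp (b * x ^ 2 : ℝ)
    rw [← Real.exp_eq_exp_ℝ] at h
    refine h.congr_fun fun d => ?_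
    rw [mul_pow]
    ring
  have hsum : Summable fun d : ℕ =>
      ∫ x, ‖b ^ d / d.factorial * (x ^ 2) ^ d‖ ∂(gaussianReal 0 1) := by
    simp_rw [Real.norm_of_nonneg (hF0 _ _)]
    refine summable_of_sum_range_le (c := ∫ x, Real.exp (b * x ^ 2) ∂(gaussianReal 0 1))
      (fun d => integral_nonneg (hF0 d)) fun N => ?_
    rw [← integral_finsetSum _ fun d _ => hF d]
    exact integral_mono (integrable_finsetSum _ fun d _ => hF d)
      (integrable_exp_sq_gaussianReal hb)
      fun x => sum_le_hasSum _ (fun d _ => hF0 d x) (hexp x)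
  have h := hasSum_integral_of_summable_integral_norm hF hsum
  simp_rw [integral_const_mul, (hexp _).tsum_eq] at h
  rwa [integral_exp_sq_gaussianReal hb] at h

end WeakLimit

/-! ### Passage to the limit for degrees `o(n / log n)` -/

section Asymptotics

variable {π : Measure ℝ} [IsProbabilityMeasure π]

lemma eventually_mul_log_le {D : ℕ → ℕ}
    (hD : (fun n : ℕ => (D n : ℝ)) =o[atTop] (fun n : ℕ => (n : ℝ) / Real.log n)) {κ : ℝ}
    (hκ : 0 < κ) : ∀ᶠ n : ℕ in atTop, D n * Real.log n ≤ κ * n := by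
  filter_upwards [hD.def hκ, eventually_ge_atTop 2] with n hn h2
  have hlog : 0 < Real.log n := Real.log_pos (by exact_mod_cast h2)
  rw [Real.norm_of_nonneg (Nat.cast_nonneg _), Real.norm_of_nonneg (by positivity),
    ← mul_div_assoc, le_div_iff₀ hlog] at hn
  exact hn

/-- Dominated convergence for the series extended by zero beyond `D n`. Each fixed degree is
eventually included because `D n` diverges, and every included degree lies in the range of the
uniform bound. -/
lemma IsSpikePrior.tendsto_sum_degreeWeight (hπ : IsSpikePrior π) {lam : ℝ}
    (hlam : lam ∈ Set.Ioo (0 : ℝ) 1) {D : ℕ → ℕ} (hDtop : Tendsto D atTop atTop)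
    (hD : (fun n : ℕ => (D n : ℝ)) =o[atTop] (fun n : ℕ => (n : ℝ) / Real.log n)) :
    Tendsto (fun n => ∑ d ∈ Finset.range (D n + 1), degreeWeight lam π n d) atTop
      (𝓝 ((1 - lam ^ 2) ^ (-(1 / 2) : ℝ))) := by
  obtain ⟨b, hbs, hb0, κ, hκ, hb⟩ := hπ.exists_summable_bound hlam
  have hlim := hasSum_gaussian_even_moments (b := lam ^ 2 / 2) (by positivity)
    (by nlinarith [hlam.1, hlam.2])
  rw [mul_div_cancel₀ _ two_ne_zero] at hlim
  rw [← hlim.tsum_eq]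
  have hts : ∀ n, ∑' d, (if d ∈ Finset.range (D n + 1) then degreeWeight lam π n d else 0)
      = ∑ d ∈ Finset.range (D n + 1), degreeWeight lam π n d := by
    intro n
    rw [tsum_eq_sum (s := Finset.range (D n + 1)) fun d hd => if_neg hd]
    exact Finset.sum_congr rfl fun d hd => if_pos hd
  refine Tendsto.congr hts (tendsto_tsum_of_dominated_convergence hbs (fun d => ?_) ?_)
  · refine (hπ.tendsto_degreeWeight hlam d).congr' ?_
    filter_upwards [hDtop.eventually_ge_atTop d] with n hn
    rw [if_pos (Finset.mem_range.2 (by omega))]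
  · filter_upwards [eventually_mul_log_le hD hκ, eventually_ge_atTop 3] with n h1 h3 d
    split_ifs with hd
    · rw [Real.norm_of_nonneg (degreeWeight_nonneg lam n d)]
      refine hb n h3 d (le_trans ?_ h1)
      have hlog : 0 ≤ Real.log n := Real.log_natCast_nonneg n
      have hdD : (d : ℝ) ≤ D n := by
        exact_mod_cast Nat.lt_succ_iff.1 (Finset.mem_range.1 hd)
      gcongr
    · simpa using hb0 d

lemma norm_lowDegreePart_eq_sqrt (lam : ℝ) (π : Measure ℝ) [IsProbabilityMeasure π] (n D : ℕ)
    (hL : MemLp (spikedLR lam π n) 2 (spikedWigner 0 π n)) :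
    ‖lowDegreePart (spikedWigner 0 π n) D (spikedLR lam π n) hL‖
      = √(∑ d ∈ Finset.range (D + 1), degreeWeight lam π n d) := by
  rw [← Real.sqrt_sq (norm_nonneg (lowDegreePart _ _ _ hL)), norm_lowDegreePart_sq]
  simp_rw [integral_overlap_eq_seqOverlap]
  rfl

/-- The low-degree norm converges when the degree grows slowly. -/
lemma IsSpikePrior.tendsto_norm_lowDegreePart (hπ : IsSpikePrior π) {lam : ℝ}
    (hlam : lam ∈ Set.Ioo (0 : ℝ) 1)
    (hL : ∀ n, MemLp (spikedLR lam π n) 2 (spikedWigner 0 π n)) {D : ℕ → ℕ}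
    (hDtop : Tendsto D atTop atTop)
    (hD : (fun n : ℕ => (D n : ℝ)) =o[atTop] (fun n : ℕ => (n : ℝ) / Real.log n)) :
    Tendsto (fun n => ‖lowDegreePart (spikedWigner 0 π n) (D n) (spikedLR lam π n) (hL n)‖) atTop
      (𝓝 ((1 - lam ^ 2) ^ (-(1 / 4) : ℝ))) := by
  have h := (hπ.tendsto_sum_degreeWeight hlam hDtop hD).sqrt
  have hpos : 0 ≤ 1 - lam ^ 2 := by nlinarith [hlam.1, hlam.2]
  rw [Real.sqrt_eq_rpow, ← Real.rpow_mul hpos] at h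
  simp_rw [norm_lowDegreePart_eq_sqrt]
  convert h using 3
  norm_num

/-- Supplies a diverging degree sequence, of order `log n`, inside the admissible range. -/
lemma log_isLittleO_div_log :
    (fun n : ℕ => Real.log n) =o[atTop] (fun n : ℕ => (n : ℝ) / Real.log n) := by
  rw [isLittleO_iff]
  intro c hc
  have h := ((Real.isLittleO_pow_log_id_atTop (n := 2)).comp_tendsto
    tendsto_natCast_atTop_atTop).def hc
  filter_upwards [h, eventually_ge_atTop 2] with n hn h2
  have hlog : 0 < Real.log n := Real.log_pos (by exact_mod_cast h2)
  simp only [Function.comp, id, norm_pow, Real.norm_of_nonneg hlog.le, Real.norm_natCast] at hn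
  rw [Real.norm_of_nonneg hlog.le, Real.norm_of_nonneg (by positivity), ← mul_div_assoc,
    le_div_iff₀ hlog, ← sq]
  exact hn

/-- The upper bound on the low-degree norm, with no lower bound on the growth of the degree. -/
lemma IsSpikePrior.eventually_norm_lowDegreePart_le (hπ : IsSpikePrior π) {lam : ℝ}
    (hlam : lam ∈ Set.Ioo (0 : ℝ) 1)
    (hL : ∀ n, MemLp (spikedLR lam π n) 2 (spikedWigner 0 π n)) {D : ℕ → ℕ}
    (hD : (fun n : ℕ => (D n : ℝ)) =o[atTop] (fun n : ℕ => (n : ℝ) / Real.log n))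
    {ε : ℝ} (hε : 0 < ε) :
    ∀ᶠ n : ℕ in atTop,
      ‖lowDegreePart (spikedWigner 0 π n) (D n) (spikedLR lam π n) (hL n)‖
        ≤ (1 - lam ^ 2) ^ (-(1 / 4) : ℝ) + ε := by
  have hfloor : (fun n : ℕ => ((⌊Real.log n⌋₊ : ℕ) : ℝ))
      =o[atTop] (fun n : ℕ => (n : ℝ) / Real.log n) := by
    refine IsBigO.trans_isLittleO (isBigO_of_le _ fun n => ?_) log_isLittleO_div_log
    rw [Real.norm_of_nonneg (Nat.cast_nonneg _), Real.norm_of_nonneg (Real.log_natCast_nonneg n)]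
    exact Nat.floor_le (Real.log_natCast_nonneg n)
  -- The enlarged degree diverges and is still `o(n / log n)`, so the limit applies to it.
  -- Nonnegative degree weights make its norm an upper bound for the one at `D n`.
  have hD' : (fun n : ℕ => ((D n + ⌊Real.log n⌋₊ : ℕ) : ℝ))
      =o[atTop] (fun n : ℕ => (n : ℝ) / Real.log n) := by
    simp_rw [Nat.cast_add]
    exact hD.add hfloor
  have htop : Tendsto (fun n : ℕ => D n + ⌊Real.log n⌋₊) atTop atTop :=
    tendsto_atTop_mono (fun n => Nat.le_add_left _ _)
      (tendsto_nat_floor_atTop.comp (Real.tendsto_log_atTop.comp tendsto_natCast_atTop_atTop))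
  have h := hπ.tendsto_norm_lowDegreePart hlam hL htop hD'
  filter_upwards [h.eventually_lt_const (lt_add_of_pos_right _ hε)] with n hn
  refine le_trans ?_ hn.le
  rw [norm_lowDegreePart_eq_sqrt, norm_lowDegreePart_eq_sqrt]
  refine Real.sqrt_le_sqrt (Finset.sum_le_sum_of_subset_of_nonneg
    (Finset.range_mono (by omega)) fun d _ _ => degreeWeight_nonneg lam n d)

end Asymptotics

end SpikedWigner

theorem theorem2p5 (lam : ℝ) (hlam : lam ∈ Set.Ioo (0 : ℝ) 1)
    (π : Measure ℝ) [IsProbabilityMeasure π] (hπ : SpikedWigner.IsSpikePrior π) :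
    -- the likelihood ratio exists and lies in `L²(P₀)`
    (∀ n : ℕ, SpikedWigner.spikedWigner lam π n ≪ SpikedWigner.spikedWigner 0 π n) ∧
    ∃ hL : ∀ n : ℕ, MemLp (SpikedWigner.spikedLR lam π n) 2 (SpikedWigner.spikedWigner 0 π n),
      -- the limit, for `D = ω(1)` and `D = o(n / log n)`
      (∀ D : ℕ → ℕ, Tendsto D atTop atTop →
        (fun n : ℕ => (D n : ℝ)) =o[atTop] (fun n : ℕ => (n : ℝ) / Real.log n) →
        Tendsto
          (fun n : ℕ => ‖SpikedWigner.lowDegreePart (SpikedWigner.spikedWigner 0 π n) (D n)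
            (SpikedWigner.spikedLR lam π n) (hL n)‖)
          atTop (𝓝 ((1 - lam ^ 2) ^ (-(1 / 4) : ℝ)))) ∧
      -- the upper bound, for `D = o(n / log n)` alone
      (∀ D : ℕ → ℕ,
        (fun n : ℕ => (D n : ℝ)) =o[atTop] (fun n : ℕ => (n : ℝ) / Real.log n) →
        ∀ ε : ℝ, 0 < ε → ∀ᶠ n : ℕ in atTop,
          ‖SpikedWigner.lowDegreePart (SpikedWigner.spikedWigner 0 π n) (D n)
            (SpikedWigner.spikedLR lam π n) (hL n)‖
            ≤ (1 - lam ^ 2) ^ (-(1 / 4) : ℝ) + ε) :=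
  ⟨fun n => SpikedWigner.spikedWigner_absolutelyContinuous lam π n,
    fun n => SpikedWigner.memLp_spikedLR lam π n,
    fun _ hDtop hD => hπ.tendsto_norm_lowDegreePart hlam _ hDtop hD,
    fun _ hD _ hε => hπ.eventually_norm_lowDegreePart_le hlam _ hD hε⟩
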